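/- Let $k\ge 3$, let $A_1,\dots,A_k$ be positive integers and $B_1,\dots,B_k$ integers, and put $L_i(n)=A_in+B_i$ and $\mathcal P(n)=\prod_{i=1}^kL_i(n)$. Assume that the tuple is admissible: the $L_i$ are pairwise distinct and, for every prime $p$, $\#\{1\le n\le p:\ \mathcal P(n)\equiv 0 \bmod p\}<p$. Let $\vartheta>0$ and $\eta>0$. Write \[\mathcal R_k=\Big\{t\in[0,1]^k:\ \sum_{i=1}^k t_i\le 1\Big\},\qquad \mathcal R_k'=\Big\{t\in[0,1]^k:\ \sum_{i\ne j}t_i\le 1\ \text{ for each } j=1,\dots,k\Big\}.\] For real $N>16$ put \[D_0=\log\log\log N,\qquad W=\prod_{p<D_0}p,\qquad R=N^{\vartheta}.\] For $F:\mathbf R^k\to\mathbf R_{\ge 0}$ put \[F_{\max}=\sup_{t\in[0,1]^k}\Big(|F(t)|+\sum_{i=1}^k\Big|\frac{\partial F}{\partial t_i}(t)\Big|\Big)\in[0,\infty]\] (a partial derivative that does not exist at $t$ is omitted). For positive integers $r_1,\dots,r_k$ with product $r$ let \[y_{r_1,\dots,r_k}=F\Big(\frac{\log r_1}{\log R},\dots,\frac{\log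 r_k}{\log R}\Big)\] if $r$ is squarefree, $(r,W)=1$ and $r/r_j<R$ for each $j$, and $y_{r_1,\dots,r_k}=0$ otherwise. Let \[\lambda_{d_1,\dots,d_k}=\Big(\prod_{i=1}^k\mu(d_i)d_i\Big)\sum_{\substack{r_1,\dots,r_k\\ \forall i\ d_i\mid r_i}}\frac{y_{r_1,\dots,r_k}}{\prod_{i=1}^k\varphi(r_i)},\qquad \Lambda_{\mathrm{Sel}}^2(n)=\Big(\sum_{\substack{d_1,\dots,d_k\\ \forall i\ d_i\mid L_i(n)}}\lambda_{d_1,\dots,d_k}\Big)^2 .\] Then there is a constant $C>0$, depending only on $\eta,\vartheta,k$ and the $A_i,B_i$, such that the following holds. Let $F:\mathbf R^k\to\mathbf R_{\ge0}$ satisfy one of the two hypotheses 1. $\vartheta<\frac12-\eta$, $F$ vanishes outside $\mathcal R_k$ and is differentiable in the interior of $\mathcal R_k$; 2. $\vartheta<\frac{k-1}{2k}-\eta$, $F$ vanishes outside $\mathcal R_k'$ and is differentiable in the interior of $\mathcal R_k'$. Then for every real $N>16$ with $D_0>A_i$ and $D_0>A_iB_j-A_jB_i$ for all $i,j$, and every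 integer $\nu_0$ with $(\mathcal P(\nu_0),W)=1$, \[\sum_{\substack{N<n\le 2N\\ n\equiv\nu_0 \bmod W\\ \mathcal P(n)\ \text{not squarefree}}}\Lambda_{\mathrm{Sel}}^2(n)\ \le\ C\,\frac{F_{\max}^2\,\varphi(W)^k\,N\,(\log R)^k}{W^{k+1}D_0}.\] -/

import Mathlib

open scoped BigOperators

noncomputable section

namespace AlmostPrimeTuples

/-! ### Linear forms and admissibility -/

/-- The linear form `L_i(n) = A_i n + B_i`. -/
def linForm {k : ℕ} (A : Fin k → ℕ) (B : Fin k → ℤ) (i : Fin k) (n : ℤ) : ℤ :=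
  (A i : ℤ) * n + B i

/-- The product `P(n) = L_1(n) ⋯ L_k(n)`. -/
def formProd {k : ℕ} (A : Fin k → ℕ) (B : Fin k → ℤ) (n : ℤ) : ℤ :=
  ∏ i, linForm A B i n

/-- The number of `1 ≤ n ≤ p` with `P(n) ≡ 0 mod p`. -/
def rootCount {k : ℕ} (A : Fin k → ℕ) (B : Fin k → ℤ) (p : ℕ) : ℕ :=
  ((Finset.Icc 1 p).filter fun n : ℕ => (p : ℤ) ∣ formProd A B (n : ℤ)).card

/-- The tuple of forms `A_i n + B_i` is admissible: it has fewer than `p` roots modulo every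
prime `p`, and the forms are pairwise distinct. -/
def Admissible {k : ℕ} (A : Fin k → ℕ) (B : Fin k → ℤ) : Prop :=
  (∀ p : ℕ, p.Prime → rootCount A B p < p) ∧
    ∀ i j : Fin k, i ≠ j → (A i, B i) ≠ (A j, B j)

/-! ### The `W`-trick -/

/-- `D_0 = log log log N`. -/
def D0 (N : ℝ) : ℝ := Real.log (Real.log (Real.log N))

/-- `W = ∏_{p < D_0} p` (a natural number is `< ⌈D_0⌉₊` exactly when it is `< D_0`). -/
def W (N : ℝ) : ℕ := ∏ p ∈ (Finset.range ⌈D0 N⌉₊).filter Nat.Prime, p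

/-! ### Supports and the size of the smooth weight -/

/-- `R_k`: points of `[0,1]^k` with coordinate sum at most `1`. -/
def simplexRegion (k : ℕ) : Set (Fin k → ℝ) :=
  {t | (∀ i, t i ∈ Set.Icc (0 : ℝ) 1) ∧ ∑ i, t i ≤ 1}

/-- `R_k'`: points of `[0,1]^k` such that, for each `j`, the sum of the coordinates other than
the `j`-th one is at most `1`. -/
def extendedRegion (k : ℕ) : Set (Fin k → ℝ) :=
  {t | (∀ i, t i ∈ Set.Icc (0 : ℝ) 1) ∧ ∀ j, ∑ i ∈ Finset.univ.erase j, t i ≤ 1}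

/-- `F_max`, the supremum over `[0,1]^k` of `|F| + ∑ |∂F/∂t_i|`, as an element of `[0, ∞]`.
At points where some partial derivative does not exist (only boundary points of the support
region, in the intended use) that derivative does not contribute. -/
def Fmax {k : ℕ} (F : (Fin k → ℝ) → ℝ) : ENNReal :=
  ⨆ t ∈ {t : Fin k → ℝ | ∀ i, t i ∈ Set.Icc (0 : ℝ) 1},
    ENNReal.ofReal (|F t| + ∑ i, |lineDeriv ℝ F t (Pi.single i 1)|)

/-! ### The sieve weights -/

open Classical in
/-- `y_{r_1,…,r_k} = F(log r_1 / log R, …, log r_k / log R)` if `r = r_1 ⋯ r_k` is squarefree and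
coprime to `W`, and `r / r_j < R` for each `j`; it is `0` otherwise. -/
def yWeight {k : ℕ} (F : (Fin k → ℝ) → ℝ) (W : ℕ) (R : ℝ) (r : Fin k → ℕ) : ℝ :=
  if Squarefree (∏ i, r i) ∧ Nat.Coprime (∏ i, r i) W ∧
      ∀ j, ((∏ i ∈ Finset.univ.erase j, r i : ℕ) : ℝ) < R
  then F fun i => Real.log (r i) / Real.log R
  else 0

/-- All `k`-tuples of natural numbers smaller than `R`; see `mem_box_of_yWeight_ne_zero` and
`mem_box_of_lamWeight_ne_zero`: for `k ≥ 2` the sieve weights vanish outside of this box. -/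
def box (k : ℕ) (R : ℝ) : Finset (Fin k → ℕ) :=
  Fintype.piFinset fun _ => Finset.range ⌈R⌉₊

open Classical in
/-- `λ_{d_1,…,d_k} = (∏ μ(d_i) d_i) ∑ y_{r_1,…,r_k} / ∏ φ(r_i)`, where the sum is over all
`r_1,…,r_k` with `d_i ∣ r_i` for each `i`. -/
def lamWeight {k : ℕ} (F : (Fin k → ℝ) → ℝ) (W : ℕ) (R : ℝ) (d : Fin k → ℕ) : ℝ :=
  (∏ i, ((ArithmeticFunction.moebius (d i) : ℤ) : ℝ) * (d i : ℝ)) *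
    ∑ r ∈ (box k R).filter (fun r => ∀ i, d i ∣ r i),
      yWeight F W R r / ∏ i, (Nat.totient (r i) : ℝ)

open Classical in
/-- `Λ_Sel²(n)`: the square of the sum of `λ_{d_1,…,d_k}` over all `d_1,…,d_k` with
`d_i ∣ L_i(n)` for each `i`. -/
def selbergSq {k : ℕ} (A : Fin k → ℕ) (B : Fin k → ℤ) (F : (Fin k → ℝ) → ℝ) (W : ℕ) (R : ℝ)
    (n : ℤ) : ℝ :=
  (∑ d ∈ (box k R).filter (fun d => ∀ i, (d i : ℤ) ∣ linForm A B i n), lamWeight F W R d) ^ 2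

/-- No tuple with a non-zero weight `y` is left out of the box. -/
theorem mem_box_of_yWeight_ne_zero {k : ℕ} (hk : 2 ≤ k) (F : (Fin k → ℝ) → ℝ) (W : ℕ) (R : ℝ)
    (r : Fin k → ℕ) (h : yWeight F W R r ≠ 0) : r ∈ box k R := by
  unfold yWeight at h
  split_ifs at h with hc
  · obtain ⟨hsq, -, hlt⟩ := hc
    have hne : ∏ i, r i ≠ 0 := hsq.ne_zero
    have hpos : ∀ i, 0 < r i := fun i =>
      Nat.pos_of_ne_zero (Finset.prod_ne_zero_iff.mp hne i (Finset.mem_univ i))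
    simp only [box, Fintype.mem_piFinset, Finset.mem_range]
    intro i
    have : Nontrivial (Fin k) := Fin.nontrivial_iff_two_le.mpr hk
    obtain ⟨j, hj⟩ := exists_ne i
    rw [Nat.lt_ceil]
    refine lt_of_le_of_lt ?_ (hlt j)
    exact_mod_cast Nat.le_of_dvd (Finset.prod_pos fun i _ => hpos i)
      (Finset.dvd_prod_of_mem r (Finset.mem_erase.mpr ⟨hj.symm, Finset.mem_univ i⟩))
  · exact absurd rfl h

/-- No tuple with a non-zero weight `λ` is left out of the box. -/
theorem mem_box_of_lamWeight_ne_zero {k : ℕ} (F : (Fin k → ℝ) → ℝ) (W : ℕ) (R : ℝ)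
    (d : Fin k → ℕ) (h : lamWeight F W R d ≠ 0) : d ∈ box k R := by
  unfold lamWeight at h
  obtain ⟨r, hr, hy⟩ := Finset.exists_ne_zero_of_sum_ne_zero (right_ne_zero_of_mul h)
  have hy' : yWeight F W R r ≠ 0 := fun h0 => hy (by rw [h0, zero_div])
  rw [Finset.mem_filter] at hr
  have hne : ∏ i, r i ≠ 0 := by
    unfold yWeight at hy'
    split_ifs at hy' with hc
    · exact hc.1.ne_zero
    · exact absurd rfl hy'
  simp only [box, Fintype.mem_piFinset, Finset.mem_range] at hr ⊢
  intro i
  exact lt_of_le_of_lt (Nat.le_of_dvd (Nat.pos_of_ne_zero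
    (Finset.prod_ne_zero_iff.mp hne i (Finset.mem_univ i))) (hr.2 i)) (hr.1 i)

open Classical in
/-- The integers `N < n ≤ 2N` with `n ≡ ν₀ mod W` and `P(n)` not squarefree. -/
def nonSquarefreeSet {k : ℕ} (A : Fin k → ℕ) (B : Fin k → ℤ) (N : ℝ) (ν₀ : ℤ) : Finset ℕ :=
  (Finset.Ioc ⌊N⌋₊ ⌊2 * N⌋₊).filter fun n =>
    (n : ℤ) ≡ ν₀ [ZMOD (W N : ℤ)] ∧ ¬ Squarefree (formProd A B (n : ℤ))

end AlmostPrimeTuples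

end

/-! A prime `q` not dividing `W` is at least `D₀`, hence divides no `A_i` and no resultant `A_i B_j
- A_j B_i`; the resultants are nonzero by admissibility. Such a prime divides at most one of the
values `L_i(n)`. Since `P(n)` is coprime to `W`, a failure of squarefreeness means that `p² ∣
L_j(n)` for one `j` and one prime `p ∤ W` (`exists_prime_sq_dvd_linForm`). The sum is covered by
three sets: zeros of some form, squares of primes up to `Z = N^η`, and squares of primes beyond `Z`
(`sum_nonSquarefreeSet_le`).

For a fixed small `p` the square defining the Selberg weight is expanded and the integers `n` are
counted in residue classes. The errors total `O((∑ |λ|)²)`. The main term is `N / W` times a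
quadratic form in `λ` whose kernel is a product over primes (`abs_card_sub_prod_kern_le`). Encoding
tuples `d` by colourings of primes with `k` colours and a blank makes every local kernel a matrix on
`k + 1` states. No asymptotic evaluation is needed: at each `q ≠ p`, adding the positive rank one
matrix with entries `1 / q²` on coloured states yields a kernel that is diagonalised exactly by the
Möbius transform defining `λ` from `y`. This bounds the form by `(k + 1)² M² / p² · (∑ m /
φ(m)²)^k`, where `M` bounds `|y|` and `m < R` is squarefree and coprime to `W` (`sum_kern_le`,
`sum_kern_sieve_le`, `sum_selbergSq_prime_sq_le`). The inner sum is `O(φ(W) / W · log R)`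
(`sum_ratio_coprime_le`), and `∑ 1 / p² ≤ 2 / D₀` supplies the saving.

All else is bounded by a power of `N` below `1`. Both hypotheses on `F` give `∏ r_i ≤ N^(1/2 - η)`
on the support of `y`, so `∑ |λ|` is at most about `N^(1/2 - η)`. For large `p` a divisor bound for
the weight (`exists_selbergSq_le`) is multiplied by the number of `n`. Since `W` is at most a
constant times `(log N)²`, such errors are absorbed (`exists_error_le`). -/

namespace AlmostPrimeTuples

/-! ### Quadratic forms of product kernels -/

section Gram

variable {ι κ : Type*} [DecidableEq ι] [Fintype κ] [DecidableEq κ]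

/-- A quadratic form whose kernel is a product of Gram kernels is a weighted sum of squares. -/
theorem sum_mul_prod_gram [Fintype ι] {X Γ : Type*} [Fintype X] [Fintype Γ]
    (w : ι → X → ℝ) (φ : ι → X → Γ → ℝ) (lam : (ι → Γ) → ℝ) :
    ∑ c, ∑ c', lam c * lam c' * ∏ q, ∑ x, w q x * φ q x (c q) * φ q x (c' q) =
      ∑ x : ι → X, (∏ q, w q (x q)) * (∑ c, lam c * ∏ q, φ q (x q) (c q)) ^ 2 := by
  have h1 : ∀ c c' : ι → Γ, ∏ q, ∑ x, w q x * φ q x (c q) * φ q x (c' q) =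
      ∑ x : ι → X, (∏ q, w q (x q)) * (∏ q, φ q (x q) (c q)) * ∏ q, φ q (x q) (c' q) := by
    intro c c'
    rw [Finset.prod_univ_sum, Fintype.piFinset_univ]
    simp only [Finset.prod_mul_distrib]
  simp only [h1, Finset.mul_sum]
  have h2 : ∀ x : ι → X, (∏ q, w q (x q)) * (∑ c, lam c * ∏ q, φ q (x q) (c q)) ^ 2 =
      ∑ c, ∑ c', lam c * lam c' *
        ((∏ q, w q (x q)) * (∏ q, φ q (x q) (c q)) * ∏ q, φ q (x q) (c' q)) := by
    intro x
    rw [sq, Finset.sum_mul_sum, Finset.mul_sum]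
    refine Finset.sum_congr rfl fun c _ => ?_
    rw [Finset.mul_sum]
    exact Finset.sum_congr rfl fun c' _ => by ring
  simp only [h2]
  conv_rhs => rw [Finset.sum_comm]
  refine Finset.sum_congr rfl fun c _ => ?_
  rw [Finset.sum_comm]

/-- The indicator of `c ≤ x` in the flat order on `Option κ`. -/
noncomputable def below (x c : Option κ) : ℝ := if c = none ∨ c = x then 1 else 0

/-- Weights on the states of a prime: `some i` means that the prime divides the `i`-th form. At the
distinguished index `p` the state is `some j` and carries the weight `1 / p²`. -/
noncomputable def density (val : ι → ℝ) (p : ι) (j : κ) (q : ι) : Option κ → ℝ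
  | none => if q = p then 0 else 1 - Fintype.card κ / val q
  | some i => if q = p then (if i = j then 1 / val p ^ 2 else 0) else 1 / val q

/-- The local kernel of the sieve. -/
noncomputable def kern (val : ι → ℝ) (p : ι) (j : κ) (q : ι) (c c' : Option κ) : ℝ :=
  ∑ x, density val p j q x * below x c * below x c'

/-- The weights of the diagonalised majorant of `kern`. -/
noncomputable def diagWeight (val : ι → ℝ) (p : ι) (q : ι) : Option κ → ℝ
  | none => if q = p then 1 / val p ^ 2 else 1
  | some _ => if q = p then 0 else 1 / val q

/-- The change of variables of the diagonalised majorant of `kern`. -/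
noncomputable def diagCoef (val : ι → ℝ) (p : ι) (j : κ) (q : ι) (b c : Option κ) : ℝ :=
  if q = p then below (some j) c else
    match b with
    | none => if c = none then 1 else 1 / val q
    | some i => if c = some i then 1 else 0

theorem kern_self (val : ι → ℝ) (p : ι) (j : κ) (c c' : Option κ) :
    kern val p j p c c' = 1 / val p ^ 2 * below (some j) c * below (some j) c' := by
  simp [kern, Fintype.sum_option, density]

theorem kern_none_none (val : ι → ℝ) (p : ι) (j : κ) {q : ι} (hq : q ≠ p) (hv : val q ≠ 0) :
    kern val p j q none none = 1 := by
  simp [kern, Fintype.sum_option, density, below, hq]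
  field_simp
  ring

theorem kern_none_some (val : ι → ℝ) (p : ι) (j : κ) {q : ι} (hq : q ≠ p) (i : κ) :
    kern val p j q none (some i) = 1 / val q := by
  simp [kern, density, below, hq]

theorem kern_some_none (val : ι → ℝ) (p : ι) (j : κ) {q : ι} (hq : q ≠ p) (i : κ) :
    kern val p j q (some i) none = 1 / val q := by
  simp [kern, density, below, hq]

theorem kern_some_some (val : ι → ℝ) (p : ι) (j : κ) {q : ι} (hq : q ≠ p) (i i' : κ) :
    kern val p j q (some i) (some i') = if i = i' then 1 / val q else 0 := by
  by_cases h : i = i'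
  · subst h
    simp [kern, density, below, hq]
  · simp [kern, density, below, hq, h, eq_comm]

/-- The majorant differs from the kernel by a rank one Gram kernel. -/
theorem sum_diag_eq (val : ι → ℝ) (p : ι) (j : κ) (q : ι) (hv : val q ≠ 0) (c c' : Option κ) :
    ∑ b, diagWeight val p q b * diagCoef val p j q b c * diagCoef val p j q b c' =
      (if q = p then 0 else 1) * (if c = none then 0 else 1 / val q) *
        (if c' = none then 0 else 1 / val q) + kern val p j q c c' := by
  by_cases hq : q = p
  · subst hq
    simp [kern_self, Fintype.sum_option, diagWeight, diagCoef]
  · rcases c with _ | i <;> rcases c' with _ | i'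
    · simp [kern_none_none val p j hq hv, Fintype.sum_option, diagWeight, diagCoef, hq]
    · simp [kern_none_some val p j hq, Fintype.sum_option, diagWeight, diagCoef, hq]
    · simp [kern_some_none val p j hq, Fintype.sum_option, diagWeight, diagCoef, hq]
    · by_cases h : i = i'
      · subst h
        simp [kern_some_some val p j hq, Fintype.sum_option, diagWeight, diagCoef, hq]
      · simp [kern_some_some val p j hq, Fintype.sum_option, diagWeight, diagCoef, hq, h]

/-- The quadratic form of the sieve is bounded by its diagonalised majorant. -/
theorem sum_kern_le [Fintype ι] (val : ι → ℝ) (p : ι) (j : κ) (hv : ∀ q, 0 < val q)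
    (hk : ∀ q, (Fintype.card κ : ℝ) ≤ val q) (lam : (ι → Option κ) → ℝ) :
    ∑ c, ∑ c', lam c * lam c' * ∏ q, kern val p j q (c q) (c' q) ≤
      ∑ b : ι → Option κ, (∏ q, diagWeight val p q (b q)) *
        (∑ c, lam c * ∏ q, diagCoef val p j q (b q) (c q)) ^ 2 := by
  have hd : ∀ q x, 0 ≤ density val p j q x := by
    intro q x
    -- The blank state has density `1 - k / q`; its nonnegativity is what makes the form a sum of
    -- squares with nonnegative weights.
    have h1 : (Fintype.card κ : ℝ) / val q ≤ 1 := (div_le_one (hv q)).mpr (hk q)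
    have h2 := hv q
    have h3 := hv p
    rcases x with _ | i
    · unfold density
      split_ifs <;> linarith
    · unfold density
      split_ifs <;> positivity
  -- The extra state `none` carries the rank one kernel of `sum_diag_eq`, the states `some x` those
  -- of `kern`. The majorant thus becomes a sum of squares over a larger index set than the sieve
  -- form.
  let w : ι → Option (Option κ) → ℝ := fun q x =>
    x.elim (if q = p then 0 else 1) (density val p j q)
  let φ : ι → Option (Option κ) → Option κ → ℝ := fun q x c =>
    x.elim (if c = none then 0 else 1 / val q) (fun y => below y c)
  have hw : ∀ q x, 0 ≤ w q x := by
    intro q x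
    rcases x with _ | x
    · simp only [w, Option.elim]
      split_ifs <;> norm_num
    · exact hd q x
  have hK : ∀ q c c', ∑ b, diagWeight val p q b * diagCoef val p j q b c *
      diagCoef val p j q b c' = ∑ x, w q x * φ q x c * φ q x c' := by
    intro q c c'
    rw [sum_diag_eq val p j q (hv q).ne', Fintype.sum_option]
    rfl
  rw [← sum_mul_prod_gram (diagWeight val p) (diagCoef val p j) lam]
  simp only [hK]
  rw [sum_mul_prod_gram w φ lam]
  simp only [kern]
  rw [sum_mul_prod_gram (density val p j) (fun _ x c => below x c) lam]
  -- State vectors that avoid the extra state everywhere reproduce the sieve form; every other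
  -- square has nonnegative weight and may be dropped.
  let e : (ι → Option κ) ↪ (ι → Option (Option κ)) :=
    ⟨fun x q => some (x q), fun x y h => funext fun q => Option.some_injective _ (congrFun h q)⟩
  calc _ = ∑ x ∈ Finset.univ.map e, (∏ q, w q (x q)) * (∑ c, lam c * ∏ q, φ q (x q) (c q)) ^ 2 := by
        rw [Finset.sum_map]
        rfl
    _ ≤ _ := Finset.sum_le_sum_of_subset_of_nonneg (Finset.subset_univ _) fun x _ _ =>
        mul_nonneg (Finset.prod_nonneg fun q _ => hw q _) (sq_nonneg _)

/-! ### The change of variables applied to the sieve weights -/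

/-- The local factor `μ(d) d`. -/
noncomputable def muFactor (v : ℝ) (c : Option κ) : ℝ := if c = none then 1 else -v

/-- The local factor `1 / φ(r)`. -/
noncomputable def phiFactor (v : ℝ) (c : Option κ) : ℝ := if c = none then 1 else 1 / (v - 1)

/-- Local Möbius inversion. For `b` blank and `r` coloured the two surviving terms are `1` and
`(-v)(1 / v)`, which cancel; the entry `1 / v` in `diagCoef` is chosen for this. -/
theorem sum_diagCoef_of_ne (val : ι → ℝ) (p : ι) (j : κ) {q : ι} (hq : q ≠ p) (hv : val q ≠ 0)
    (b r : Option κ) :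
    ∑ c, muFactor (val q) c * below r c * diagCoef val p j q b c =
      if r = b then muFactor (val q) b else 0 := by
  rcases b with _ | i <;> rcases r with _ | i'
  · simp [Fintype.sum_option, muFactor, below, diagCoef, hq]
  · simp [Fintype.sum_option, muFactor, below, diagCoef, hq, hv]
  · simp [muFactor, below, diagCoef, hq]
  · by_cases h : i' = i
    · simp [muFactor, below, diagCoef, hq, h]
    · simp [muFactor, below, diagCoef, hq, eq_comm]

/-- At the prime whose square is imposed there is no inversion: the transform does not force `r =
b`, and all colours of `r` contribute. -/
theorem sum_diagCoef_self (val : ι → ℝ) (p : ι) (j : κ) (b r : Option κ) :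
    ∑ c, muFactor (val p) c * below r c * diagCoef val p j p b c =
      if r = some j then 1 - val p else 1 := by
  rcases r with _ | i
  · simp [Fintype.sum_option, muFactor, below, diagCoef]
  · by_cases h : i = j
    · simp [Fintype.sum_option, muFactor, below, diagCoef, h]
      ring
    · simp [Fintype.sum_option, muFactor, below, diagCoef, h, Ne.symm h]

/-- The local factor `r / φ(r)²`. -/
noncomputable def ratioFactor (v : ℝ) (c : Option κ) : ℝ :=
  if c = none then 1 else v / (v - 1) ^ 2

/-- The value `1 - v` is compensated by `1 / φ = 1 / (v - 1)`, so each of the `k + 1` states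
contributes at most `1`. This loses only a constant at `p`. -/
theorem sum_phiFactor_self_le (v : ℝ) (hv : 2 ≤ v) (j : κ) :
    ∑ r : Option κ, phiFactor v r * |if r = some j then 1 - v else 1| ≤ Fintype.card κ + 1 := by
  have hv1 : v - 1 ≠ 0 := by linarith
  have h : ∀ r : Option κ, phiFactor v r * |if r = some j then 1 - v else 1| ≤ 1 := by
    intro r
    unfold phiFactor
    split_ifs with h1 h2 h2
    · simp [h1] at h2
    · simp
    · rw [abs_of_nonpos (by linarith), neg_sub, one_div, inv_mul_cancel₀ hv1]
    · rw [abs_one, mul_one, div_le_one (by linarith)]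
      linarith
  calc _ ≤ ∑ r : Option κ, (1 : ℝ) := Finset.sum_le_sum fun r _ => h r
    _ = _ := by simp

/-- Upper bound for the diagonalised majorant at the sieve weights
`lam c = μ(c) c ∑_{r ≥ c} Y r / φ(r)`. -/
theorem sum_kern_sieve_le [Fintype ι] (val : ι → ℝ) (p : ι) (j : κ) (hv : ∀ q, 2 ≤ val q)
    (hk : ∀ q, (Fintype.card κ : ℝ) ≤ val q) (Y lam : (ι → Option κ) → ℝ)
    (hlam : ∀ c, lam c = (∏ q, muFactor (val q) (c q)) *
      ∑ r, Y r * (∏ q, phiFactor (val q) (r q)) * ∏ q, below (r q) (c q))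
    (T : Finset (ι → Option κ)) (M : ℝ) (hM : ∀ r, |Y r| ≤ M)
    (hT : ∀ r b, Y r ≠ 0 → b p = none → (∀ q, q ≠ p → r q = b q) → b ∈ T) :
    ∑ c, ∑ c', lam c * lam c' * ∏ q, kern val p j q (c q) (c' q) ≤
      (Fintype.card κ + 1) ^ 2 * M ^ 2 / val p ^ 2 * ∑ b ∈ T, ∏ q, ratioFactor (val q) (b q) := by
  classical
  have hM0 : 0 ≤ M := (abs_nonneg _).trans (hM fun _ => none)
  have hv0 : ∀ q, 0 < val q := fun q => by linarith [hv q]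
  have hphi : ∀ q (x : Option κ), 0 ≤ phiFactor (val q) x := by
    intro q x
    have := hv q
    unfold phiFactor
    split_ifs
    · norm_num
    · exact div_nonneg zero_le_one (by linarith)
  refine (sum_kern_le val p j hv0 hk lam).trans ?_
  set t : ι → Option κ → Option κ → ℝ := fun q b r =>
    ∑ c, muFactor (val q) c * below r c * diagCoef val p j q b c with ht
  have hu : ∀ b : ι → Option κ, ∑ c, lam c * ∏ q, diagCoef val p j q (b q) (c q) =
      ∑ r, Y r * ∏ q, (phiFactor (val q) (r q) * t q (b q) (r q)) := by
    intro b
    have h1 : ∀ r : ι → Option κ, ∏ q, t q (b q) (r q) =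
        ∑ c : ι → Option κ, (∏ q, muFactor (val q) (c q)) * (∏ q, below (r q) (c q)) *
          ∏ q, diagCoef val p j q (b q) (c q) := by
      intro r
      simp only [ht]
      rw [Finset.prod_univ_sum, Fintype.piFinset_univ]
      simp only [Finset.prod_mul_distrib]
    simp only [hlam, Finset.prod_mul_distrib, h1, Finset.mul_sum, Finset.sum_mul]
    rw [Finset.sum_comm]
    exact Finset.sum_congr rfl fun r _ => Finset.sum_congr rfl fun c _ => by ring
  -- At `p` the majorant has rank one, carried by the blank state alone.
  have hzero : ∀ b : ι → Option κ, b p ≠ none → ∏ q, diagWeight val p q (b q) = 0 := by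
    intro b hb
    obtain ⟨i, hi⟩ := Option.ne_none_iff_exists'.mp hb
    refine Finset.prod_eq_zero (Finset.mem_univ p) ?_
    rw [hi]
    simp [diagWeight]
  have hdw : ∀ q (x : Option κ), 0 ≤ diagWeight val p q x := by
    intro q x
    have h1 := hv0 q
    have h2 := hv0 p
    rcases x with _ | i
    · unfold diagWeight
      split_ifs <;> positivity
    · unfold diagWeight
      split_ifs <;> positivity
  -- A bound for the local sums over `r q`: `k + 1` at `p`, and elsewhere the single term `r q = b
  -- q`.
  set s : ι → Option κ → ℝ := fun q x =>
    if q = p then (Fintype.card κ + 1 : ℝ) else phiFactor (val q) x * |muFactor (val q) x| with hs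
  have hub : ∀ b : ι → Option κ, b p = none →
      |∑ r, Y r * ∏ q, (phiFactor (val q) (r q) * t q (b q) (r q))| ≤
        if b ∈ T then M * ∏ q, s q (b q) else 0 := by
    intro b hb
    have hsum : ∀ q, ∑ x, |phiFactor (val q) x * t q (b q) x| ≤ s q (b q) := by
      intro q
      simp only [abs_mul, abs_of_nonneg (hphi q _), hs, ht]
      by_cases hq : q = p
      · subst hq
        simp only [sum_diagCoef_self, if_true]
        exact sum_phiFactor_self_le (val q) (hv q) j
      · simp only [sum_diagCoef_of_ne val p j hq (hv0 q).ne', if_neg hq]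
        rw [Finset.sum_eq_single (b q)]
        · simp
        · intro r _ hr
          simp [hr]
        · simp
    by_cases hbT : b ∈ T
    · rw [if_pos hbT]
      calc _ ≤ ∑ r, |Y r * ∏ q, (phiFactor (val q) (r q) * t q (b q) (r q))| :=
            Finset.abs_sum_le_sum_abs _ _
        _ ≤ ∑ r : ι → Option κ, M * ∏ q, |phiFactor (val q) (r q) * t q (b q) (r q)| := by
            refine Finset.sum_le_sum fun r _ => ?_
            rw [abs_mul, Finset.abs_prod]
            exact mul_le_mul_of_nonneg_right (hM r) (Finset.prod_nonneg fun _ _ => abs_nonneg _)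
        _ = M * ∏ q, ∑ x, |phiFactor (val q) x * t q (b q) x| := by
            rw [Finset.prod_univ_sum, Fintype.piFinset_univ, Finset.mul_sum]
        _ ≤ M * ∏ q, s q (b q) := by
            refine mul_le_mul_of_nonneg_left ?_ hM0
            exact Finset.prod_le_prod
              (fun q _ => Finset.sum_nonneg fun _ _ => abs_nonneg _) fun q _ => hsum q
    · rw [if_neg hbT, abs_nonpos_iff]
      refine Finset.sum_eq_zero fun r _ => ?_
      by_cases hY : Y r = 0
      · rw [hY, zero_mul]
      -- If `Y r ≠ 0` and `b ∉ T`, then `r` and `b` differ at some `q ≠ p`, where the inverted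
      -- factor vanishes.
      · have : ∃ q, q ≠ p ∧ r q ≠ b q := by
          by_contra! hcon
          exact hbT (hT r b hY hb hcon)
        obtain ⟨q, hq, hrb⟩ := this
        rw [Finset.prod_eq_zero (Finset.mem_univ q), mul_zero]
        simp only [ht]
        rw [sum_diagCoef_of_ne val p j hq (hv0 q).ne', if_neg hrb, mul_zero]
  have hterm : ∀ b : ι → Option κ, (∏ q, diagWeight val p q (b q)) *
      (∑ c, lam c * ∏ q, diagCoef val p j q (b q) (c q)) ^ 2 ≤
      if b ∈ T then (Fintype.card κ + 1) ^ 2 * M ^ 2 / val p ^ 2 *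
        ∏ q, ratioFactor (val q) (b q) else 0 := by
    intro b
    have hrat : 0 ≤ ∏ q, ratioFactor (val q) (b q) := by
      refine Finset.prod_nonneg fun q _ => ?_
      unfold ratioFactor
      split_ifs
      · norm_num
      · exact div_nonneg (hv0 q).le (sq_nonneg _)
    by_cases hb : b p = none
    · rw [hu]
      have h2 := hub b hb
      split_ifs at h2 ⊢ with hbT
      · have hsq : (∑ r, Y r * ∏ q, (phiFactor (val q) (r q) * t q (b q) (r q))) ^ 2 ≤
            (M * ∏ q, s q (b q)) ^ 2 := by
          rw [← sq_abs]
          exact pow_le_pow_left₀ (abs_nonneg _) h2 2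
        calc _ ≤ (∏ q, diagWeight val p q (b q)) * (M * ∏ q, s q (b q)) ^ 2 :=
              mul_le_mul_of_nonneg_left hsq (Finset.prod_nonneg fun q _ => hdw q _)
          _ = M ^ 2 * ∏ q, (diagWeight val p q (b q) * s q (b q) ^ 2) := by
              rw [Finset.prod_mul_distrib, Finset.prod_pow]
              ring
          -- At a coloured `q ≠ p` the weights combine to `(1 / v) (v / (v - 1))² = v / (v - 1)²`.
          -- At `p` only the constant `(k + 1)² / v²` remains.
          _ = M ^ 2 * ∏ q, ((if q = p then (Fintype.card κ + 1 : ℝ) ^ 2 / val p ^ 2 else 1) *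
                ratioFactor (val q) (b q)) := by
              congr 1
              refine Finset.prod_congr rfl fun q _ => ?_
              by_cases hq : q = p
              · subst hq
                simp [hb, diagWeight, hs, ratioFactor]
                ring
              · have h1 : val q - 1 ≠ 0 := by linarith [hv q]
                have h0 := (hv0 q).ne'
                rcases hbq : b q with _ | i
                · simp [diagWeight, hs, ratioFactor, hq, phiFactor, muFactor]
                · simp only [diagWeight, hs, ratioFactor, hq, phiFactor, muFactor, if_false,
                    reduceCtorEq, one_mul, mul_pow, sq_abs]
                  field_simp
          _ = _ := by
              rw [Finset.prod_mul_distrib, Finset.prod_ite_eq' Finset.univ p]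
              simp
              ring
      · rw [abs_nonpos_iff] at h2
        rw [h2]
        simp
    · rw [hzero b hb, zero_mul]
      split_ifs
      · positivity
      · exact le_rfl
  calc _ ≤ ∑ b : ι → Option κ, if b ∈ T then (Fintype.card κ + 1) ^ 2 * M ^ 2 / val p ^ 2 *
        ∏ q, ratioFactor (val q) (b q) else 0 := Finset.sum_le_sum fun b _ => hterm b
    _ = _ := by
      rw [Finset.sum_ite_mem, Finset.univ_inter, Finset.mul_sum]

end Gram

/-! ### Colourings of a set of primes and squarefree tuples -/

section Parts

variable {k : ℕ} {P : Finset ℕ}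

/-- The `i`-th component of the tuple encoded by a colouring of the primes in `P`. -/
def part (c : P → Option (Fin k)) (i : Fin k) : ℕ := ∏ q with c q = some i, (q : ℕ)

theorem prime_dvd_part_iff (hP : ∀ q ∈ P, q.Prime) (c : P → Option (Fin k)) (i : Fin k) {p : ℕ}
    (hp : p.Prime) : p ∣ part c i ↔ ∃ h : p ∈ P, c ⟨p, h⟩ = some i := by
  unfold part
  rw [hp.prime.dvd_finsetProd_iff]
  constructor
  · rintro ⟨q, hq, hd⟩
    rw [(Nat.prime_dvd_prime_iff_eq hp (hP q q.2))] at hd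
    subst hd
    exact ⟨q.2, (Finset.mem_filter.mp hq).2⟩
  · rintro ⟨h, hc⟩
    exact ⟨⟨p, h⟩, by simp [hc], dvd_rfl⟩

theorem part_pos (hP : ∀ q ∈ P, q.Prime) (c : P → Option (Fin k)) (i : Fin k) : 0 < part c i :=
  Finset.prod_pos fun q _ => (hP q q.2).pos

theorem part_injective (hP : ∀ q ∈ P, q.Prime) :
    Function.Injective (part : (P → Option (Fin k)) → Fin k → ℕ) := by
  intro c c' h
  have key : ∀ q : P, ∀ i, c q = some i ↔ c' q = some i := by
    intro q i
    have h1 := prime_dvd_part_iff hP c i (hP q q.2)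
    have h2 := prime_dvd_part_iff hP c' i (hP q q.2)
    rw [h] at h1
    have h3 := h1.symm.trans h2
    simpa using h3
  funext q
  exact Option.ext fun i => by simpa using key q i

theorem part_cast_dvd_iff (hP : ∀ q ∈ P, q.Prime) (c : P → Option (Fin k)) (i : Fin k) (z : ℤ) :
    (part c i : ℤ) ∣ z ↔ ∀ q : P, c q = some i → ((q : ℕ) : ℤ) ∣ z := by
  unfold part
  constructor
  · intro h q hq
    refine dvd_trans ?_ h
    exact_mod_cast Finset.dvd_prod_of_mem (fun q : P => (q : ℕ)) (by simp [hq])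
  · intro h
    rw [Nat.cast_prod]
    refine Finset.prod_dvd_of_coprime ?_ fun q hq => h q (Finset.mem_filter.mp hq).2
    intro q _ q' _ hne
    rw [Function.onFun, Nat.isCoprime_iff_coprime]
    exact (Nat.coprime_primes (hP q q.2) (hP q' q'.2)).mpr fun e => hne (Subtype.ext e)

theorem part_dvd_part_iff (hP : ∀ q ∈ P, q.Prime) (c r : P → Option (Fin k)) :
    (∀ i, part c i ∣ part r i) ↔ ∀ q, c q = none ∨ c q = r q := by
  have h1 : ∀ i, part c i ∣ part r i ↔ ∀ q : P, c q = some i → r q = some i := by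
    intro i
    rw [← Int.natCast_dvd_natCast, part_cast_dvd_iff hP]
    refine forall_congr' fun q => imp_congr_right fun _ => ?_
    rw [Int.natCast_dvd_natCast, prime_dvd_part_iff hP r i (hP q q.2)]
    simp
  simp only [h1]
  constructor
  · intro h q
    rcases hc : c q with _ | i
    · exact Or.inl rfl
    · exact Or.inr (h i q hc).symm
  · intro h i q hc
    rcases h q with h2 | h2
    · rw [hc] at h2
      cases h2
    · rw [← h2, hc]

theorem prod_prod_colour {M : Type*} [CommMonoid M] (c : P → Option (Fin k)) (g : P → M) :
    ∏ i, ∏ q with c q = some i, g q = ∏ q, if c q = none then 1 else g q := by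
  rw [← Finset.prod_fiberwise Finset.univ c, Fintype.prod_option]
  have h1 : ∏ q with c q = none, (if c q = none then 1 else g q) = 1 :=
    Finset.prod_eq_one fun q hq => if_pos (Finset.mem_filter.mp hq).2
  rw [h1, one_mul]
  refine Finset.prod_congr rfl fun i _ => Finset.prod_congr rfl fun q hq => ?_
  rw [(Finset.mem_filter.mp hq).2]
  simp

theorem map_prod_of_pairwise_coprime {ι M : Type*} [CommMonoid M] (f : ℕ → M) (h1 : f 1 = 1)
    (hmul : ∀ m n, Nat.Coprime m n → f (m * n) = f m * f n) (g : ι → ℕ) (s : Finset ι)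
    (hs : (s : Set ι).Pairwise fun a b => Nat.Coprime (g a) (g b)) :
    f (∏ a ∈ s, g a) = ∏ a ∈ s, f (g a) := by
  classical
  induction s using Finset.induction_on with
  | empty => simpa using h1
  | insert a s ha ih =>
    rw [Finset.prod_insert ha, Finset.prod_insert ha, hmul, ih]
    · exact hs.mono (by simp)
    · refine Nat.Coprime.prod_right fun b hb => hs (by simp) (by simp [hb]) ?_
      rintro rfl
      exact ha hb

theorem coprime_of_ne (hP : ∀ q ∈ P, q.Prime) {q q' : P} (h : q ≠ q') :
    Nat.Coprime (q : ℕ) (q' : ℕ) :=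
  (Nat.coprime_primes (hP q q.2) (hP q' q'.2)).mpr fun e => h (Subtype.ext e)

theorem map_part {M : Type*} [CommMonoid M] (hP : ∀ q ∈ P, q.Prime) (f : ℕ → M) (h1 : f 1 = 1)
    (hmul : ∀ m n, Nat.Coprime m n → f (m * n) = f m * f n) (c : P → Option (Fin k)) (i : Fin k) :
    f (part c i) = ∏ q with c q = some i, f q :=
  map_prod_of_pairwise_coprime f h1 hmul _ _ fun _ _ _ _ h => coprime_of_ne hP h

theorem prod_map_part {M : Type*} [CommMonoid M] (hP : ∀ q ∈ P, q.Prime) (f : ℕ → M)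
    (h1 : f 1 = 1) (hmul : ∀ m n, Nat.Coprime m n → f (m * n) = f m * f n)
    (c : P → Option (Fin k)) :
    ∏ i, f (part c i) = ∏ q : P, if c q = none then 1 else f q := by
  rw [← prod_prod_colour c fun q => f q]
  exact Finset.prod_congr rfl fun i _ => map_part hP f h1 hmul c i

theorem squarefree_part (hP : ∀ q ∈ P, q.Prime) (c : P → Option (Fin k)) (i : Fin k) :
    Squarefree (part c i) :=
  Finset.squarefree_prod_of_pairwise_isCoprime
    (fun _ _ _ _ h => Nat.coprime_iff_isRelPrime.mp (coprime_of_ne hP h))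
    fun q _ => (hP q q.2).prime.squarefree

/-- Squarefreeness of the whole product, not just of each `d i`, prevents a prime from needing two
colours. -/
theorem exists_part_eq (hP : ∀ q ∈ P, q.Prime) (d : Fin k → ℕ) (hsq : Squarefree (∏ i, d i))
    (hd : ∀ i p, p.Prime → p ∣ d i → p ∈ P) : ∃ c : P → Option (Fin k), part c = d := by
  classical
  let c : P → Option (Fin k) := fun q =>
    if h : ∃ i, (q : ℕ) ∣ d i then some h.choose else none
  have hc : ∀ (q : P) i, c q = some i ↔ (q : ℕ) ∣ d i := by
    intro q i
    have huniq : ∀ i', (q : ℕ) ∣ d i' → (q : ℕ) ∣ d i → i' = i := by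
      intro i' h1 h2
      by_contra hne
      have h3 : d i' * d i ∣ ∏ i, d i := by
        rw [← Finset.prod_pair hne]
        exact Finset.prod_dvd_prod_of_subset _ _ _ (Finset.subset_univ _)
      have h4 := hsq _ ((mul_dvd_mul h1 h2).trans h3)
      exact (hP q q.2).one_lt.ne' (Nat.isUnit_iff.mp h4)
    by_cases h : ∃ i, (q : ℕ) ∣ d i
    · simp only [c, dif_pos h, Option.some.injEq]
      constructor
      · rintro rfl
        exact h.choose_spec
      · exact huniq _ h.choose_spec
    · simp only [c, dif_neg h]
      simp only [reduceCtorEq, false_iff]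
      exact fun h' => h ⟨i, h'⟩
  refine ⟨c, funext fun i => ?_⟩
  have hsqi : Squarefree (d i) :=
    hsq.squarefree_of_dvd (Finset.dvd_prod_of_mem d (Finset.mem_univ i))
  have hne : d i ≠ 0 := hsqi.ne_zero
  refine (Nat.Squarefree.ext_iff (squarefree_part hP c i) hsqi).mpr fun p hp => ?_
  rw [prime_dvd_part_iff hP c i hp]
  constructor
  · rintro ⟨h, h'⟩
    exact (hc ⟨p, h⟩ i).mp h'
  · intro h
    exact ⟨hd i p hp h, (hc _ i).mpr h⟩

theorem sum_eq_sum_part (hP : ∀ q ∈ P, q.Prime) (G : (Fin k → ℕ) → ℝ) (S : Finset (Fin k → ℕ))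
    (hS : ∀ c : P → Option (Fin k), G (part c) ≠ 0 → part c ∈ S)
    (hG : ∀ d ∈ S, G d ≠ 0 → ∃ c : P → Option (Fin k), part c = d) :
    ∑ d ∈ S, G d = ∑ c : P → Option (Fin k), G (part c) := by
  symm
  refine Finset.sum_bij_ne_zero (fun c _ _ => part c) (fun c _ h => hS c h)
    (fun c _ _ c' _ _ h => part_injective hP h) ?_ fun _ _ _ => rfl
  intro d hd h
  obtain ⟨c, hc⟩ := hG d hd h
  exact ⟨c, Finset.mem_univ _, by rwa [hc], hc⟩

end Parts

/-! ### The sieve weights in terms of colourings -/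

section Weights

variable {k : ℕ} {P : Finset ℕ} {F : (Fin k → ℝ) → ℝ} {W : ℕ} {R X : ℝ}

theorem yWeight_conditions {r : Fin k → ℕ} (h : yWeight F W R r ≠ 0) :
    Squarefree (∏ i, r i) ∧ Nat.Coprime (∏ i, r i) W ∧
      ∀ j, ((∏ i ∈ Finset.univ.erase j, r i : ℕ) : ℝ) < R := by
  unfold yWeight at h
  split_ifs at h with hc
  · exact hc
  · exact absurd rfl h

theorem exists_yWeight_of_lamWeight {d : Fin k → ℕ} (h : lamWeight F W R d ≠ 0) :
    ∃ r ∈ box k R, (∀ i, d i ∣ r i) ∧ yWeight F W R r ≠ 0 := by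
  unfold lamWeight at h
  obtain ⟨r, hr, hy⟩ := Finset.exists_ne_zero_of_sum_ne_zero (right_ne_zero_of_mul h)
  rw [Finset.mem_filter] at hr
  exact ⟨r, hr.1, hr.2, fun h0 => hy (by rw [h0, zero_div])⟩

/-- `P` consists of the primes up to `X` that do not divide `W`. -/
def IsSievePrimes (P : Finset ℕ) (W : ℕ) (X : ℝ) : Prop :=
  ∀ q, q ∈ P ↔ q.Prime ∧ ¬ q ∣ W ∧ (q : ℝ) ≤ X

theorem IsSievePrimes.prime (hP : IsSievePrimes P W X) : ∀ q ∈ P, q.Prime :=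
  fun q hq => ((hP q).mp hq).1

theorem exists_part_eq_of_dvd (hP : IsSievePrimes P W X) (hRX : R ≤ X) {d r : Fin k → ℕ}
    (hbox : r ∈ box k R) (hdr : ∀ i, d i ∣ r i) (hy : yWeight F W R r ≠ 0) :
    ∃ c : P → Option (Fin k), part c = d := by
  obtain ⟨hsq, hco, -⟩ := yWeight_conditions hy
  refine exists_part_eq hP.prime d
    (hsq.squarefree_of_dvd (Finset.prod_dvd_prod_of_dvd _ _ fun i _ => hdr i)) fun i p hp hpd => ?_
  have hpr : p ∣ r i := hpd.trans (hdr i)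
  have hri : r i ≠ 0 := fun h0 => hsq.ne_zero (Finset.prod_eq_zero (Finset.mem_univ i) h0)
  refine (hP p).mpr ⟨hp, fun hpW => ?_, ?_⟩
  · have h1 := Nat.dvd_gcd (hpr.trans (Finset.dvd_prod_of_mem r (Finset.mem_univ i))) hpW
    rw [hco] at h1
    exact hp.one_lt.ne' (Nat.dvd_one.mp h1)
  · simp only [box, Fintype.mem_piFinset, Finset.mem_range] at hbox
    have h1 : (r i : ℝ) < R := Nat.lt_ceil.mp (hbox i)
    have h2 : (p : ℝ) ≤ r i := by exact_mod_cast Nat.le_of_dvd (Nat.pos_of_ne_zero hri) hpr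
    linarith

theorem prod_below_eq {c r : P → Option (Fin k)} :
    ∏ q, below (r q) (c q) = if ∀ q, c q = none ∨ c q = r q then 1 else 0 := by
  simp only [below]
  rw [Finset.prod_ite_zero]
  simp

/-- The factors `μ(d) d`, `1 / φ(r)` and the relation `d ∣ r` all split over primes, which puts `λ`
into the shape required by `sum_kern_sieve_le`. -/
theorem lamWeight_part (hk : 2 ≤ k) (hP : IsSievePrimes P W X) (hRX : R ≤ X)
    (c : P → Option (Fin k)) :
    lamWeight F W R (part c) = (∏ q : P, muFactor ((q : ℕ) : ℝ) (c q)) *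
      ∑ r : P → Option (Fin k), yWeight F W R (part r) *
        (∏ q : P, phiFactor ((q : ℕ) : ℝ) (r q)) * ∏ q, below (r q) (c q) := by
  classical
  have hmu : ∏ i, ((ArithmeticFunction.moebius (part c i) : ℤ) : ℝ) * (part c i : ℝ) =
      ∏ q : P, muFactor ((q : ℕ) : ℝ) (c q) := by
    rw [prod_map_part hP.prime (fun n => ((ArithmeticFunction.moebius n : ℤ) : ℝ) * (n : ℝ))
      (by simp) (fun m n h => by
        rw [ArithmeticFunction.isMultiplicative_moebius.map_mul_of_coprime h]
        push_cast
        ring) c]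
    refine Finset.prod_congr rfl fun q _ => ?_
    unfold muFactor
    rw [ArithmeticFunction.moebius_apply_prime (hP.prime q q.2)]
    simp
  have hphi : ∀ r : P → Option (Fin k), ∏ i, ((part r i).totient : ℝ) =
      (∏ q : P, phiFactor ((q : ℕ) : ℝ) (r q))⁻¹ := by
    intro r
    rw [prod_map_part hP.prime (fun n => (n.totient : ℝ)) (by simp) (fun m n h => by
        rw [Nat.totient_mul h]
        push_cast
        ring) r, ← Finset.prod_inv_distrib]
    refine Finset.prod_congr rfl fun q _ => ?_
    unfold phiFactor
    have := (hP.prime q q.2).one_le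
    rw [Nat.totient_prime (hP.prime q q.2)]
    push_cast [this]
    split_ifs <;> simp
  unfold lamWeight
  rw [hmu, Finset.sum_filter, sum_eq_sum_part hP.prime]
  · congr 1
    refine Finset.sum_congr rfl fun r _ => ?_
    rw [prod_below_eq, hphi, div_inv_eq_mul]
    simp only [part_dvd_part_iff hP.prime]
    split_ifs <;> simp
  · intro r hr
    have h1 : yWeight F W R (part r) ≠ 0 := by
      intro h0
      rw [h0] at hr
      simp at hr
    exact mem_box_of_yWeight_ne_zero hk F W R _ h1
  · intro r hr h
    have h1 : yWeight F W R r ≠ 0 := by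
      intro h0
      rw [h0] at h
      simp at h
    exact exists_part_eq_of_dvd hP hRX hr (fun _ => dvd_rfl) h1

/-- Sums over the box involving the weights `λ` are sums over colourings. -/
theorem sum_box_lamWeight (hP : IsSievePrimes P W X) (hRX : R ≤ X)
    (G : (Fin k → ℕ) → ℝ) (hG : ∀ d, lamWeight F W R d = 0 → G d = 0) :
    ∑ d ∈ box k R, G d = ∑ c : P → Option (Fin k), G (part c) := by
  refine sum_eq_sum_part hP.prime G _ (fun c hc => ?_) fun d _ h => ?_
  · exact mem_box_of_lamWeight_ne_zero F W R _ fun h0 => hc (hG _ h0)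
  · obtain ⟨r, hr, hdr, hy⟩ := exists_yWeight_of_lamWeight fun h0 => h (hG _ h0)
    exact exists_part_eq_of_dvd hP hRX hr hdr hy

/-- All primes of the colouring divide the form prescribed by their colour. -/
def Divides (A : Fin k → ℕ) (B : Fin k → ℤ) (c : P → Option (Fin k)) (n : ℤ) : Prop :=
  ∀ q i, c q = some i → ((q : ℕ) : ℤ) ∣ linForm A B i n

open Classical in
theorem selbergSq_eq (hP : IsSievePrimes P W X) (hRX : R ≤ X) (A : Fin k → ℕ) (B : Fin k → ℤ)
    (n : ℤ) : selbergSq A B F W R n =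
      (∑ c : P → Option (Fin k), if Divides A B c n then lamWeight F W R (part c) else 0) ^ 2 := by
  unfold selbergSq
  rw [Finset.sum_filter, sum_box_lamWeight (F := F) hP hRX]
  · congr 1
    refine Finset.sum_congr rfl fun c _ => if_congr ?_ rfl rfl
    simp only [part_cast_dvd_iff hP.prime, Divides]
    exact forall_comm
  · intro d h
    simp [h]

/-- Since `m / φ(m)²` is multiplicative, a colouring contributes the product of its values at the
parts. Injectivity of `part` embeds `T` into `U^k`, where the sum factors. -/
theorem sum_ratioFactor_le (hP : ∀ q ∈ P, q.Prime) (T : Finset (P → Option (Fin k)))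
    (U : Finset ℕ) (hT : ∀ b ∈ T, ∀ i, part b i ∈ U) :
    ∑ b ∈ T, ∏ q : P, ratioFactor ((q : ℕ) : ℝ) (b q) ≤
      (∑ m ∈ U, (m : ℝ) / (m.totient : ℝ) ^ 2) ^ k := by
  classical
  have h1 : ∀ b : P → Option (Fin k), ∏ q : P, ratioFactor ((q : ℕ) : ℝ) (b q) =
      ∏ i, ((part b i : ℝ) / ((part b i).totient : ℝ) ^ 2) := by
    intro b
    rw [prod_map_part hP (fun m => (m : ℝ) / (m.totient : ℝ) ^ 2) (by simp) (fun m n h => by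
        rw [Nat.totient_mul h]
        push_cast
        rw [mul_pow, mul_div_mul_comm]) b]
    refine Finset.prod_congr rfl fun q _ => ?_
    unfold ratioFactor
    rw [Nat.totient_prime (hP q q.2)]
    push_cast [(hP q q.2).one_le]
    rfl
  simp only [h1]
  have h2 : (∑ m ∈ U, (m : ℝ) / (m.totient : ℝ) ^ 2) ^ k =
      ∑ d ∈ Fintype.piFinset fun _ : Fin k => U, ∏ i, ((d i : ℝ) / ((d i).totient : ℝ) ^ 2) := by
    rw [← Finset.prod_univ_sum (fun _ : Fin k => U)
      (fun _ m => (m : ℝ) / (m.totient : ℝ) ^ 2)]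
    simp
  rw [h2]
  rw [← Finset.sum_image (f := fun d : Fin k → ℕ => ∏ i, ((d i : ℝ) / ((d i).totient : ℝ) ^ 2))
    (g := part) (s := T) fun b _ b' _ h => part_injective hP h]
  refine Finset.sum_le_sum_of_subset_of_nonneg ?_ fun d _ _ =>
    Finset.prod_nonneg fun i _ => by positivity
  intro d hd
  obtain ⟨b, hb, rfl⟩ := Finset.mem_image.mp hd
  exact Fintype.mem_piFinset.mpr fun i => hT b hb i

end Weights

/-! ### Counting integers in residue classes -/

theorem exists_dvd_iff_modEq {a m : ℤ} (b : ℤ) (h : IsCoprime a m) :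
    ∃ x : ℤ, ∀ n : ℤ, m ∣ a * n + b ↔ n ≡ x [ZMOD m] := by
  obtain ⟨u, v, huv⟩ := h
  refine ⟨-(u * b), fun n => ?_⟩
  have h1 : a * (n + u * b) = a * n + b - m * (v * b) := by linear_combination b * huv
  have h2 : m ∣ a * n + b ↔ m ∣ a * (n + u * b) := by
    rw [h1, dvd_sub_left (dvd_mul_right _ _)]
  rw [h2, Int.modEq_comm, Int.modEq_iff_dvd, sub_neg_eq_add]
  exact ⟨(IsCoprime.symm ⟨u, v, huv⟩).dvd_of_dvd_mul_left, fun h => h.mul_left a⟩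

theorem exists_modEq_and_iff {m m' : ℤ} (h : IsCoprime m m') (x x' : ℤ) :
    ∃ y : ℤ, ∀ n : ℤ, (n ≡ x [ZMOD m] ∧ n ≡ x' [ZMOD m']) ↔ n ≡ y [ZMOD m * m'] := by
  have hc : m.natAbs.Coprime m'.natAbs := Int.isCoprime_iff_gcd_eq_one.mp h
  obtain ⟨u, v, huv⟩ := h
  refine ⟨x * (v * m') + x' * (u * m), fun n => ?_⟩
  have h1 : x * (v * m') + x' * (u * m) ≡ x [ZMOD m] := by
    rw [Int.modEq_comm, Int.modEq_iff_dvd]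
    exact ⟨u * (x' - x), by linear_combination x * huv⟩
  have h2 : x * (v * m') + x' * (u * m) ≡ x' [ZMOD m'] := by
    rw [Int.modEq_comm, Int.modEq_iff_dvd]
    exact ⟨v * (x - x'), by linear_combination x' * huv⟩
  rw [← Int.modEq_and_modEq_iff_modEq_mul hc]
  exact and_congr ⟨fun h => h.trans h1.symm, fun h => h.trans h1⟩
    ⟨fun h => h.trans h2.symm, fun h => h.trans h2⟩

theorem exists_forall_modEq_iff {ι : Type*} (s : Finset ι) (m : ι → ℤ) (x : ι → ℤ) (m₀ x₀ : ℤ)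
    (h₀ : ∀ q ∈ s, IsCoprime m₀ (m q))
    (h : (s : Set ι).Pairwise fun q q' => IsCoprime (m q) (m q')) :
    ∃ y : ℤ, ∀ n : ℤ, (n ≡ x₀ [ZMOD m₀] ∧ ∀ q ∈ s, n ≡ x q [ZMOD m q]) ↔
      n ≡ y [ZMOD m₀ * ∏ q ∈ s, m q] := by
  classical
  induction s using Finset.induction_on with
  | empty => exact ⟨x₀, by simp⟩
  | insert a s ha ih =>
    obtain ⟨y, hy⟩ := ih (fun q hq => h₀ q (Finset.mem_insert_of_mem hq)) (h.mono (by simp))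
    have hc : IsCoprime (m₀ * ∏ q ∈ s, m q) (m a) := by
      refine IsCoprime.mul_left (h₀ a (Finset.mem_insert_self a s)) (IsCoprime.prod_left ?_)
      intro q hq
      refine h (by simp [hq]) (by simp) ?_
      rintro rfl
      exact ha hq
    obtain ⟨z, hz⟩ := exists_modEq_and_iff hc y (x a)
    refine ⟨z, fun n => ?_⟩
    rw [Finset.prod_insert ha, mul_comm (m a), ← mul_assoc, ← hz, ← hy, Finset.forall_mem_insert]
    tauto

/-- One unit of error comes from the rounding of the two quotients, another from replacing the
floors of `N` and `2N` by the numbers themselves. -/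
theorem abs_card_modEq_sub_le {N : ℝ} (hN : 0 ≤ N) {m : ℕ} (hm : 0 < m) (x : ℤ) :
    |(((Finset.Ioc ⌊N⌋₊ ⌊2 * N⌋₊).filter fun n : ℕ => (n : ℤ) ≡ x [ZMOD (m : ℤ)]).card : ℝ) -
      N / m| ≤ 2 := by
  have hm' : (0 : ℝ) < m := by exact_mod_cast hm
  have hmz : (m : ℤ) ≠ 0 := by exact_mod_cast hm.ne'
  obtain ⟨v, hv⟩ := Int.eq_ofNat_of_zero_le (Int.emod_nonneg x hmz)
  have hcong : ∀ n : ℕ, (n : ℤ) ≡ x [ZMOD (m : ℤ)] ↔ n ≡ v [MOD m] := by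
    intro n
    rw [← Int.natCast_modEq_iff]
    have : (v : ℤ) ≡ x [ZMOD (m : ℤ)] := by
      have h1 : (v : ℤ) = x % m := hv.symm
      rw [h1]
      exact Int.mod_modEq x m
    exact ⟨fun h => h.trans this.symm, fun h => h.trans this⟩
  simp only [hcong]
  have hcard := Nat.Ioc_filter_modEq_card ⌊N⌋₊ ⌊2 * N⌋₊ hm v
  set a := ⌊N⌋₊
  set b := ⌊2 * N⌋₊
  have hab : a ≤ b := Nat.floor_le_floor (by linarith)
  have ha1 : (a : ℝ) ≤ N := Nat.floor_le hN
  have ha2 : N < a + 1 := Nat.lt_floor_add_one N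
  have hb1 : (b : ℝ) ≤ 2 * N := Nat.floor_le (by linarith)
  have hb2 : 2 * N < b + 1 := Nat.lt_floor_add_one _
  have hle : ((a : ℚ) - v) / m ≤ ((b : ℚ) - v) / m := by
    have : (a : ℚ) ≤ b := by exact_mod_cast hab
    gcongr
  rw [max_eq_left (sub_nonneg.mpr (Int.floor_le_floor hle))] at hcard
  have hcard' : (((Finset.Ioc a b).filter fun n => n ≡ v [MOD m]).card : ℝ) =
      (⌊((b : ℚ) - v) / m⌋ : ℝ) - (⌊((a : ℚ) - v) / m⌋ : ℝ) := by exact_mod_cast hcard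
  rw [hcard']
  have f1 : ((⌊((b : ℚ) - v) / m⌋ : ℤ) : ℝ) ≤ ((b : ℝ) - v) / m := by
    exact_mod_cast Int.floor_le (((b : ℚ) - v) / m)
  have f2 : ((b : ℝ) - v) / m < ((⌊((b : ℚ) - v) / m⌋ : ℤ) : ℝ) + 1 := by
    exact_mod_cast Int.lt_floor_add_one (((b : ℚ) - v) / m)
  have f3 : ((⌊((a : ℚ) - v) / m⌋ : ℤ) : ℝ) ≤ ((a : ℝ) - v) / m := by
    exact_mod_cast Int.floor_le (((a : ℚ) - v) / m)
  have f4 : ((a : ℝ) - v) / m < ((⌊((a : ℚ) - v) / m⌋ : ℤ) : ℝ) + 1 := by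
    exact_mod_cast Int.lt_floor_add_one (((a : ℚ) - v) / m)
  have hm1 : (1 : ℝ) ≤ m := by exact_mod_cast hm
  have e1 : ((b : ℝ) - v) / m - ((a : ℝ) - v) / m = (b - a) / m := by ring
  have e2 : ((b : ℝ) - a) / m ≤ N / m + 1 := by
    rw [div_le_iff₀ hm', add_mul, div_mul_cancel₀ _ hm'.ne']
    linarith
  have e3 : N / m - 1 ≤ ((b : ℝ) - a) / m := by
    rw [le_div_iff₀ hm', sub_mul, div_mul_cancel₀ _ hm'.ne']
    linarith
  rw [abs_le]
  constructor <;> linarith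

/-! ### Primes and linear forms -/

section Forms

variable {k : ℕ} {P : Finset ℕ} {A : Fin k → ℕ} {B : Fin k → ℤ}

/-- The prime `q` divides none of the leading coefficients and none of the resultants. -/
def IsGoodPrime (A : Fin k → ℕ) (B : Fin k → ℤ) (q : ℕ) : Prop :=
  q.Prime ∧ (∀ i, ¬ q ∣ A i) ∧ ∀ i j, i ≠ j → ¬ (q : ℤ) ∣ (A i : ℤ) * B j - (A j : ℤ) * B i

theorem IsGoodPrime.eq_of_dvd {q : ℕ} (h : IsGoodPrime A B q) {i j : Fin k} {n : ℤ}
    (hi : (q : ℤ) ∣ linForm A B i n) (hj : (q : ℤ) ∣ linForm A B j n) : i = j := by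
  by_contra hne
  refine h.2.2 i j hne ?_
  have h1 : (A i : ℤ) * B j - (A j : ℤ) * B i =
      (A i : ℤ) * linForm A B j n - (A j : ℤ) * linForm A B i n := by
    unfold linForm
    ring
  rw [h1]
  exact dvd_sub (Dvd.dvd.mul_left hj _) (Dvd.dvd.mul_left hi _)

theorem IsGoodPrime.isCoprime {q : ℕ} (h : IsGoodPrime A B q) (i : Fin k) :
    IsCoprime (A i : ℤ) (q : ℤ) :=
  Nat.isCoprime_iff_coprime.mpr ((Nat.Prime.coprime_iff_not_dvd h.1).mpr (h.2.1 i)).symm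

theorem IsGoodPrime.exists_root {q : ℕ} (h : IsGoodPrime A B q) (i : Fin k) :
    ∃ x : ℤ, ∀ n : ℤ, (q : ℤ) ∣ linForm A B i n ↔ n ≡ x [ZMOD (q : ℤ)] :=
  exists_dvd_iff_modEq (B i) (h.isCoprime i)

theorem IsGoodPrime.exists_root_sq {q : ℕ} (h : IsGoodPrime A B q) (i : Fin k) :
    ∃ x : ℤ, ∀ n : ℤ, (q : ℤ) ^ 2 ∣ linForm A B i n ↔ n ≡ x [ZMOD (q : ℤ) ^ 2] :=
  exists_dvd_iff_modEq (B i) (h.isCoprime i).pow_right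

/-- The roots of the forms modulo a good prime are distinct. -/
theorem IsGoodPrime.le {q : ℕ} (h : IsGoodPrime A B q) : k ≤ q := by
  have : NeZero q := ⟨h.1.ne_zero⟩
  choose x hx using fun i => h.exists_root i
  have hinj : Function.Injective fun i => ((x i : ℤ) : ZMod q) := by
    intro i j hij
    have h1 : x i ≡ x j [ZMOD (q : ℤ)] := (ZMod.intCast_eq_intCast_iff _ _ _).mp hij
    exact h.eq_of_dvd ((hx i (x i)).mpr (Int.ModEq.refl _)) ((hx j (x i)).mpr h1)
  simpa [ZMod.card] using Fintype.card_le_of_injective _ hinj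

/-! ### Local densities and the contribution of one prime square -/

open Classical in
/-- The number of `n` subject to the congruences prescribed by two colourings, and with
`p² ∣ L_j(n)`, is given by the product of the local kernels up to a bounded error. -/
theorem abs_card_sub_prod_kern_le (hP : ∀ q ∈ P, IsGoodPrime A B q) {W : ℕ} (hW : 0 < W)
    (hPW : ∀ q ∈ P, ¬ q ∣ W) {N : ℝ} (hN : 0 ≤ N) (ν₀ : ℤ) (p : P) (j : Fin k)
    (c c' : P → Option (Fin k)) :
    |(((Finset.Ioc ⌊N⌋₊ ⌊2 * N⌋₊).filter fun n : ℕ => ((n : ℤ) ≡ ν₀ [ZMOD (W : ℤ)] ∧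
        ((p : ℕ) : ℤ) ^ 2 ∣ linForm A B j n) ∧ Divides A B c n ∧ Divides A B c' n).card : ℝ) -
      N / W * ∏ q : P, kern (fun q : P => ((q : ℕ) : ℝ)) p j q (c q) (c' q)| ≤ 2 := by
  let cond : P → ℤ → Prop := fun q n =>
    (q = p → ((p : ℕ) : ℤ) ^ 2 ∣ linForm A B j n) ∧
      (∀ i, c q = some i → ((q : ℕ) : ℤ) ∣ linForm A B i n) ∧
      ∀ i, c' q = some i → ((q : ℕ) : ℤ) ∣ linForm A B i n
  have hcond : ∀ n : ℕ, (((n : ℤ) ≡ ν₀ [ZMOD (W : ℤ)] ∧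
        ((p : ℕ) : ℤ) ^ 2 ∣ linForm A B j n) ∧ Divides A B c n ∧ Divides A B c' n) ↔
      ((n : ℤ) ≡ ν₀ [ZMOD (W : ℤ)] ∧ ∀ q, cond q n) := by
    intro n
    simp only [cond, forall_and, forall_eq, Divides, and_assoc]
  simp only [hcond]
  -- At each prime the conditions are either contradictory, with vanishing kernel, or a single class
  -- modulo `q ^ e` of density `1 / q ^ e`. Here `e = 2` at `p`; elsewhere `e = 0` if both colours
  -- are blank and `e = 1` otherwise.
  have hloc : ∀ q : P, ((∀ n, ¬ cond q n) ∧
        kern (fun q : P => ((q : ℕ) : ℝ)) p j q (c q) (c' q) = 0) ∨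
      ∃ (e : ℕ) (x : ℤ), (∀ n, cond q n ↔ n ≡ x [ZMOD ((q : ℕ) : ℤ) ^ e]) ∧
        kern (fun q : P => ((q : ℕ) : ℝ)) p j q (c q) (c' q) = 1 / ((q : ℕ) : ℝ) ^ e := by
    intro q
    have hg := hP q q.2
    have hq0 : ((q : ℕ) : ℝ) ≠ 0 := by exact_mod_cast hg.1.ne_zero
    by_cases hqp : q = p
    · subst hqp
      obtain ⟨x, hx⟩ := hg.exists_root_sq j
      by_cases hb : (c q = none ∨ c q = some j) ∧ (c' q = none ∨ c' q = some j)
      · refine Or.inr ⟨2, x, fun n => ?_, ?_⟩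
        · rw [← hx n]
          simp only [cond, forall_const]
          refine ⟨fun h => h.1, fun h => ⟨h, ?_, ?_⟩⟩
          · intro i hi
            rcases hb.1 with h1 | h1
            · simp [h1] at hi
            · rw [h1, Option.some.injEq] at hi
              rw [← hi]
              exact (dvd_pow_self _ two_ne_zero).trans h
          · intro i hi
            rcases hb.2 with h1 | h1
            · simp [h1] at hi
            · rw [h1, Option.some.injEq] at hi
              rw [← hi]
              exact (dvd_pow_self _ two_ne_zero).trans h
        · rw [kern_self]
          simp [below, hb]
      · refine Or.inl ⟨fun n hn => hb ?_, ?_⟩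
        · simp only [cond, forall_const] at hn
          have hj : ((q : ℕ) : ℤ) ∣ linForm A B j n := (dvd_pow_self _ two_ne_zero).trans hn.1
          constructor
          · rcases hc : c q with _ | i
            · exact Or.inl rfl
            · exact Or.inr (by rw [hg.eq_of_dvd (hn.2.1 i hc) hj])
          · rcases hc : c' q with _ | i
            · exact Or.inl rfl
            · exact Or.inr (by rw [hg.eq_of_dvd (hn.2.2 i hc) hj])
        · rw [kern_self]
          rw [not_and_or] at hb
          rcases hb with hb | hb <;> simp [below, hb]
    · rcases hc : c q with _ | i <;> rcases hc' : c' q with _ | i'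
      · exact Or.inr ⟨0, 0, fun n => by simp [cond, hqp, hc, hc', Int.modEq_one],
          by rw [kern_none_none _ _ _ hqp hq0]; simp⟩
      · obtain ⟨x, hx⟩ := hg.exists_root i'
        exact Or.inr ⟨1, x, fun n => by simp [cond, hqp, hc, hc', hx],
          by rw [kern_none_some _ _ _ hqp]; simp⟩
      · obtain ⟨x, hx⟩ := hg.exists_root i
        exact Or.inr ⟨1, x, fun n => by simp [cond, hqp, hc, hc', hx],
          by rw [kern_some_none _ _ _ hqp]; simp⟩
      · rw [kern_some_some _ _ _ hqp]
        by_cases hii : i = i'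
        · subst hii
          obtain ⟨x, hx⟩ := hg.exists_root i
          exact Or.inr ⟨1, x, fun n => by simp [cond, hqp, hc, hc', hx], by simp⟩
        · refine Or.inl ⟨fun n hn => hii ?_, by simp [hii]⟩
          exact hg.eq_of_dvd (hn.2.1 i hc) (hn.2.2 i' hc')
  by_cases hex : ∃ q, (∀ n, ¬ cond q n) ∧
      kern (fun q : P => ((q : ℕ) : ℝ)) p j q (c q) (c' q) = 0
  · obtain ⟨q, hq, hq0⟩ := hex
    rw [Finset.prod_eq_zero (Finset.mem_univ q) hq0, Finset.filter_false_of_mem]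
    · simp
    · exact fun n _ h => hq n (h.2 q)
  · push Not at hex
    have hloc' : ∀ q : P, ∃ (e : ℕ) (x : ℤ), (∀ n, cond q n ↔ n ≡ x [ZMOD ((q : ℕ) : ℤ) ^ e]) ∧
        kern (fun q : P => ((q : ℕ) : ℝ)) p j q (c q) (c' q) = 1 / ((q : ℕ) : ℝ) ^ e := by
      intro q
      rcases hloc q with h | h
      · exact absurd h.2 (hex q h.1)
      · exact h
    choose e x hx hke using hloc'
    obtain ⟨y, hy⟩ := exists_forall_modEq_iff Finset.univ
      (fun q : P => ((q : ℕ) : ℤ) ^ e q) x W ν₀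
      (fun q _ => IsCoprime.pow_right (Nat.isCoprime_iff_coprime.mpr
        ((Nat.Prime.coprime_iff_not_dvd (hP q q.2).1).mpr (hPW q q.2)).symm))
      (fun q _ q' _ hne => IsCoprime.pow (Nat.isCoprime_iff_coprime.mpr
        (coprime_of_ne (fun q hq => (hP q hq).1) hne)))
    have hy' : ∀ n : ℕ, ((n : ℤ) ≡ ν₀ [ZMOD (W : ℤ)] ∧ ∀ q, cond q n) ↔
        (n : ℤ) ≡ y [ZMOD ((W * ∏ q : P, (q : ℕ) ^ e q : ℕ) : ℤ)] := by
      intro n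
      push_cast
      rw [← hy]
      simp only [hx, Finset.mem_univ, forall_const]
    simp only [hy', hke]
    have hprod : N / W * ∏ q : P, 1 / ((q : ℕ) : ℝ) ^ e q =
        N / ((W * ∏ q : P, (q : ℕ) ^ e q : ℕ) : ℝ) := by
      push_cast
      simp only [one_div]
      rw [Finset.prod_inv_distrib, div_mul_eq_div_div, div_eq_mul_inv (N / W)]
    rw [hprod]
    have hpos : 0 < W * ∏ q : P, (q : ℕ) ^ e q :=
      Nat.mul_pos hW (Finset.prod_pos fun q _ => pow_pos (hP (q : ℕ) q.2).1.pos _)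
    have hfin := abs_card_modEq_sub_le hN hpos y
    convert hfin

open Classical in
/-- The contribution to the sieve of the `n` with `p² ∣ L_j(n)`, for a sieving prime `p`. -/
theorem sum_selbergSq_prime_sq_le (hk : 2 ≤ k) {W : ℕ} (hW : 0 < W) {R X N M : ℝ}
    (hP : IsSievePrimes P W X) (hgood : ∀ q ∈ P, IsGoodPrime A B q) (hRX : R ≤ X)
    (hN : 0 ≤ N) (ν₀ : ℤ) (p : P) (j : Fin k) (F : (Fin k → ℝ) → ℝ)
    (hM : ∀ r, |yWeight F W R r| ≤ M) :
    ∑ n ∈ (Finset.Ioc ⌊N⌋₊ ⌊2 * N⌋₊).filter (fun n : ℕ => (n : ℤ) ≡ ν₀ [ZMOD (W : ℤ)] ∧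
        ((p : ℕ) : ℤ) ^ 2 ∣ linForm A B j n), selbergSq A B F W R n ≤
      N / W * ((k + 1) ^ 2 * M ^ 2 / ((p : ℕ) : ℝ) ^ 2 *
        (∑ m ∈ (Finset.range ⌈R⌉₊).filter (fun m => Squarefree m ∧ Nat.Coprime m W),
          (m : ℝ) / (m.totient : ℝ) ^ 2) ^ k) +
        2 * (∑ d ∈ box k R, |lamWeight F W R d|) ^ 2 := by
  set lam : (P → Option (Fin k)) → ℝ := fun c => lamWeight F W R (part c) with hlam
  set val : P → ℝ := fun q => ((q : ℕ) : ℝ) with hval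
  set S := (Finset.Ioc ⌊N⌋₊ ⌊2 * N⌋₊).filter (fun n : ℕ => (n : ℤ) ≡ ν₀ [ZMOD (W : ℤ)] ∧
        ((p : ℕ) : ℤ) ^ 2 ∣ linForm A B j n) with hS
  have hexp : ∑ n ∈ S, selbergSq A B F W R n = ∑ c, ∑ c', lam c * lam c' *
      ((S.filter fun n : ℕ => Divides A B c n ∧ Divides A B c' n).card : ℝ) := by
    simp only [selbergSq_eq hP hRX, sq, Finset.sum_mul_sum]
    rw [Finset.sum_comm]
    refine Finset.sum_congr rfl fun c _ => ?_
    rw [Finset.sum_comm]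
    refine Finset.sum_congr rfl fun c' _ => ?_
    rw [Finset.card_filter, Nat.cast_sum, Finset.mul_sum]
    refine Finset.sum_congr rfl fun n _ => ?_
    by_cases h1 : Divides A B c n <;> by_cases h2 : Divides A B c' n <;> simp [h1, h2, hlam]
  have hcount : ∀ c c', |((S.filter fun n : ℕ => Divides A B c n ∧ Divides A B c' n).card : ℝ) -
      N / W * ∏ q : P, kern val p j q (c q) (c' q)| ≤ 2 := by
    intro c c'
    rw [hS, Finset.filter_filter]
    exact abs_card_sub_prod_kern_le hgood hW (fun q hq => ((hP q).mp hq).2.1) hN ν₀ p j c c'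
  have hmain : ∑ c, ∑ c', lam c * lam c' * ∏ q, kern val p j q (c q) (c' q) ≤
      (k + 1) ^ 2 * M ^ 2 / ((p : ℕ) : ℝ) ^ 2 *
        (∑ m ∈ (Finset.range ⌈R⌉₊).filter (fun m => Squarefree m ∧ Nat.Coprime m W),
          (m : ℝ) / (m.totient : ℝ) ^ 2) ^ k := by
    set U := (Finset.range ⌈R⌉₊).filter (fun m => Squarefree m ∧ Nat.Coprime m W) with hU
    -- Blanking the colour of `p` in a tuple supporting `y` replaces each part by a divisor of it,
    -- so the result stays in `T`.
    set T : Finset (P → Option (Fin k)) := Finset.univ.filter fun b => ∀ i, part b i ∈ U with hT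
    have h1 := sum_kern_sieve_le val p j
      (fun q => by simpa [hval] using Nat.cast_le (α := ℝ).mpr (hgood q q.2).1.two_le)
      (fun q => by
        rw [Fintype.card_fin]
        exact Nat.cast_le.mpr (hgood q q.2).le)
      (fun r => yWeight F W R (part r)) lam (fun c => lamWeight_part hk hP hRX c) T M
      (fun r => hM _) (by
        intro r b hr hbp hrb
        have hbox := mem_box_of_yWeight_ne_zero hk F W R _ hr
        simp only [box, Fintype.mem_piFinset, Finset.mem_range] at hbox
        refine Finset.mem_filter.mpr ⟨Finset.mem_univ _, fun i => ?_⟩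
        refine Finset.mem_filter.mpr ⟨Finset.mem_range.mpr ?_, squarefree_part hP.prime b i, ?_⟩
        · refine lt_of_le_of_lt (Nat.le_of_dvd (part_pos hP.prime r i) ?_) (hbox i)
          refine (part_dvd_part_iff hP.prime b r).mpr (fun q => ?_) i
          by_cases hq : q = p
          · exact Or.inl (hq ▸ hbp)
          · exact Or.inr (hrb q hq).symm
        · exact Nat.Coprime.prod_left fun q _ =>
            (Nat.Prime.coprime_iff_not_dvd (hP.prime q q.2)).mpr ((hP q).mp q.2).2.1)
    rw [Fintype.card_fin] at h1
    refine h1.trans (mul_le_mul_of_nonneg_left ?_ (by positivity))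
    exact sum_ratioFactor_le hP.prime T U fun b hb i => (Finset.mem_filter.mp hb).2 i
  have hbox : ∑ d ∈ box k R, |lamWeight F W R d| = ∑ c, |lam c| :=
    sum_box_lamWeight (F := F) hP hRX (fun d => |lamWeight F W R d|) fun d h => by simp [h]
  rw [hexp, hbox]
  -- Replacing each count by its main term costs at most `2 |λ| |λ'|` per pair of colourings, hence
  -- `2 (∑ |λ|)²` in total.
  calc _ ≤ ∑ c, ∑ c', (N / W * (lam c * lam c' * ∏ q, kern val p j q (c q) (c' q)) +
        2 * (|lam c| * |lam c'|)) := by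
        refine Finset.sum_le_sum fun c _ => Finset.sum_le_sum fun c' _ => ?_
        have h1 : lam c * lam c' *
            (((S.filter fun n : ℕ => Divides A B c n ∧ Divides A B c' n).card : ℝ) -
              N / W * ∏ q : P, kern val p j q (c q) (c' q)) ≤ |lam c * lam c'| * 2 := by
          refine (le_abs_self _).trans ?_
          rw [abs_mul]
          exact mul_le_mul_of_nonneg_left (hcount c c') (abs_nonneg _)
        rw [abs_mul] at h1
        linarith
    _ = N / W * ∑ c, ∑ c', lam c * lam c' * ∏ q, kern val p j q (c q) (c' q) +
        2 * (∑ c, |lam c|) ^ 2 := by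
        simp only [Finset.sum_add_distrib, ← Finset.mul_sum, sq, Finset.sum_mul]
    _ ≤ _ := by
        gcongr

end Forms

/-! ### Elementary estimates -/

/-- The number of squarefree divisors of `n` is `O(n ^ ε)`. -/
theorem exists_two_pow_card_primeFactors_le {ε : ℝ} (hε : 0 < ε) :
    ∃ C : ℝ, 1 ≤ C ∧ ∀ n : ℕ, n ≠ 0 → (2 : ℝ) ^ n.primeFactors.card ≤ C * (n : ℝ) ^ ε := by
  -- Primes above `2 ^ (1 / ε)` satisfy `2 ≤ p ^ ε`; only the boundedly many smaller ones cost a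
  -- factor `2`.
  set K := ⌈(2 : ℝ) ^ (1 / ε)⌉₊ with hK
  refine ⟨2 ^ (K + 1), one_le_pow₀ one_le_two, fun n hn => ?_⟩
  have hp1 : ∀ p ∈ n.primeFactors, (1 : ℝ) ≤ p := fun p hp => by
    exact_mod_cast (Nat.prime_of_mem_primeFactors hp).one_le
  have h1 : ∀ p ∈ n.primeFactors, (2 : ℝ) ≤ (if p ≤ K then 2 else 1) * (p : ℝ) ^ ε := by
    intro p hp
    have hp2 : (1 : ℝ) ≤ (p : ℝ) ^ ε := Real.one_le_rpow (hp1 p hp) hε.le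
    split_ifs with h
    · linarith
    · rw [one_mul]
      have h2 : (2 : ℝ) ^ (1 / ε) ≤ p := (Nat.le_ceil _).trans (by exact_mod_cast (not_le.mp h).le)
      calc (2 : ℝ) = ((2 : ℝ) ^ (1 / ε)) ^ ε := by
            rw [← Real.rpow_mul (by norm_num), one_div_mul_cancel hε.ne', Real.rpow_one]
        _ ≤ (p : ℝ) ^ ε := Real.rpow_le_rpow (by positivity) h2 hε.le
  have h2 : ∏ p ∈ n.primeFactors, (if p ≤ K then (2 : ℝ) else 1) ≤ 2 ^ (K + 1) := by
    rw [Finset.prod_ite, Finset.prod_const_one, mul_one, Finset.prod_const]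
    refine pow_le_pow_right₀ one_le_two ?_
    rw [← Finset.card_range (K + 1)]
    refine Finset.card_le_card fun p hp => ?_
    rw [Finset.mem_range]
    exact Nat.lt_succ_of_le (Finset.mem_filter.mp hp).2
  have h3 : ∏ p ∈ n.primeFactors, (p : ℝ) ^ ε ≤ (n : ℝ) ^ ε := by
    rw [Real.finsetProd_rpow _ _ fun p _ => Nat.cast_nonneg p]
    refine Real.rpow_le_rpow (Finset.prod_nonneg fun p _ => Nat.cast_nonneg p) ?_ hε.le
    rw [← Nat.cast_prod]
    exact Nat.cast_le.mpr (Nat.le_of_dvd (Nat.pos_of_ne_zero hn) (Nat.prod_primeFactors_dvd n))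
  calc (2 : ℝ) ^ n.primeFactors.card = ∏ p ∈ n.primeFactors, (2 : ℝ) := by
        rw [Finset.prod_const]
    _ ≤ ∏ p ∈ n.primeFactors, ((if p ≤ K then 2 else 1) * (p : ℝ) ^ ε) :=
        Finset.prod_le_prod (fun _ _ => by norm_num) h1
    _ ≤ _ := by
        rw [Finset.prod_mul_distrib]
        exact mul_le_mul h2 h3 (Finset.prod_nonneg fun p _ => by positivity) (by positivity)

/-! ### Totients and the sum of `m / φ(m)²` -/

theorem two_le_cast_of_mem_primeFactors {n p : ℕ} (hp : p ∈ n.primeFactors) : (2 : ℝ) ≤ p := by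
  exact_mod_cast (Nat.prime_of_mem_primeFactors hp).two_le

theorem totient_cast_eq (n : ℕ) :
    (n.totient : ℝ) = n * ∏ p ∈ n.primeFactors, (1 - (p : ℝ)⁻¹) := by
  have h := congrArg (fun x : ℚ => (x : ℝ)) (Nat.totient_eq_mul_prod_factors n)
  push_cast at h
  exact h

theorem le_two_pow_mul_totient (n : ℕ) :
    (n : ℝ) ≤ 2 ^ n.primeFactors.card * n.totient := by
  rw [totient_cast_eq]
  have h : (1 / 2 : ℝ) ^ n.primeFactors.card ≤ ∏ p ∈ n.primeFactors, (1 - (p : ℝ)⁻¹) := by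
    rw [← Finset.prod_const]
    refine Finset.prod_le_prod (fun _ _ => by norm_num) fun p hp => ?_
    have := inv_anti₀ (by norm_num) (two_le_cast_of_mem_primeFactors hp)
    norm_num at this ⊢
    linarith
  calc (n : ℝ) = 2 ^ n.primeFactors.card * (n * (1 / 2 : ℝ) ^ n.primeFactors.card) := by
        rw [mul_left_comm, ← mul_pow]
        norm_num
    _ ≤ _ := by gcongr

theorem sum_inv_Ico_le (n : ℕ) : ∑ m ∈ Finset.Ico 1 n, (m : ℝ)⁻¹ ≤ 1 + Real.log n := by
  have h := harmonic_le_one_add_log n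
  rw [harmonic_eq_sum_Icc] at h
  push_cast at h
  refine le_trans (Finset.sum_le_sum_of_subset_of_nonneg (fun m hm => ?_) fun _ _ _ => by
    positivity) h
  rw [Finset.mem_Ico] at hm
  exact Finset.mem_Icc.mpr ⟨hm.1, hm.2.le⟩

theorem sum_inv_multiples_le (d n : ℕ) :
    ∑ r ∈ (Finset.Ico 1 n).filter (d ∣ ·), (r : ℝ)⁻¹ ≤
      (d : ℝ)⁻¹ * ∑ m ∈ Finset.Ico 1 n, (m : ℝ)⁻¹ := by
  rw [Finset.mul_sum]
  have hsub : (Finset.Ico 1 n).filter (d ∣ ·) ⊆ (Finset.Ico 1 n).image (d * ·) := by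
    intro r hr
    simp only [Finset.mem_filter, Finset.mem_Ico] at hr
    obtain ⟨⟨h1, h2⟩, m, rfl⟩ := hr
    have hd : 0 < d := Nat.pos_of_mul_pos_right h1
    have hm : 0 < m := Nat.pos_of_mul_pos_left h1
    exact Finset.mem_image.mpr ⟨m, Finset.mem_Ico.mpr
      ⟨hm, (Nat.le_mul_of_pos_left m hd).trans_lt h2⟩, rfl⟩
  rcases Nat.eq_zero_or_pos d with rfl | hd
  · refine le_trans (le_of_eq (Finset.sum_eq_zero fun r hr => ?_))
      (Finset.sum_nonneg fun _ _ => by positivity)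
    simp only [Finset.mem_filter, zero_dvd_iff] at hr
    simp [hr.2]
  · calc _ ≤ ∑ r ∈ (Finset.Ico 1 n).image (d * ·), (r : ℝ)⁻¹ :=
          Finset.sum_le_sum_of_subset_of_nonneg hsub fun _ _ _ => by positivity
      _ = ∑ m ∈ Finset.Ico 1 n, ((d * m : ℕ) : ℝ)⁻¹ :=
          Finset.sum_image fun a _ b _ h => Nat.eq_of_mul_eq_mul_left hd h
      _ = _ := Finset.sum_congr rfl fun m _ => by push_cast; rw [mul_inv]

/-- The factors `(1 - 1/p)⁻²` of `x² / φ(x)²` are at most `1 + 8/p`. Opening the product over sets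
of primes and summing `1 / x` over multiples leaves the convergent product `∏ (1 + 8/q²)` times a
harmonic sum. -/
theorem sum_ratio_squarefree_le (n : ℕ) :
    ∑ x ∈ (Finset.range n).filter Squarefree, (x : ℝ) / (x.totient : ℝ) ^ 2 ≤
      Real.exp 8 * (1 + Real.log n) := by
  set Q := (Finset.range n).filter Nat.Prime with hQ
  have hlocal : ∀ x ∈ (Finset.range n).filter Squarefree, (x : ℝ) / (x.totient : ℝ) ^ 2 ≤
      ∑ t ∈ Q.powerset, if (∏ q ∈ t, q) ∣ x then (∏ q ∈ t, (8 / q : ℝ)) * (x : ℝ)⁻¹ else 0 := by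
    intro x hx
    rw [Finset.mem_filter, Finset.mem_range] at hx
    have hx0 : (0 : ℝ) < x := by exact_mod_cast Nat.pos_of_ne_zero hx.2.ne_zero
    have hprod : 0 < ∏ p ∈ x.primeFactors, (1 - (p : ℝ)⁻¹) :=
      Finset.prod_pos fun p hp => by
        have := inv_anti₀ (by norm_num) (two_le_cast_of_mem_primeFactors hp)
        norm_num at this ⊢
        linarith
    have h1 : (x : ℝ) / (x.totient : ℝ) ^ 2 ≤
        (∏ p ∈ x.primeFactors, (1 + 8 / p : ℝ)) * (x : ℝ)⁻¹ := by
      rw [totient_cast_eq, mul_pow, div_le_iff₀ (by positivity), ← Finset.prod_pow]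
      have h2 : 1 ≤ (∏ p ∈ x.primeFactors, (1 + 8 / p : ℝ)) *
          ∏ p ∈ x.primeFactors, (1 - (p : ℝ)⁻¹) ^ 2 := by
        rw [← Finset.prod_mul_distrib]
        refine le_trans (le_of_eq Finset.prod_const_one.symm)
          (Finset.prod_le_prod (fun _ _ => zero_le_one) fun p hp => ?_)
        have hp2 := two_le_cast_of_mem_primeFactors hp
        have hp0 : (0 : ℝ) < p := by linarith
        rw [← sub_nonneg]
        -- With the constant `8` the numerator `6p² - 15p + 8` is nonnegative from `p = 2` on.
        have : (1 + 8 / p : ℝ) * (1 - (p : ℝ)⁻¹) ^ 2 - 1 =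
            (6 * (p : ℝ) ^ 2 - 15 * p + 8) / p ^ 3 := by
          field_simp
          ring
        rw [this]
        refine div_nonneg ?_ (by positivity)
        nlinarith
      calc (x : ℝ) = 1 * x := (one_mul _).symm
        _ ≤ _ * x := mul_le_mul_of_nonneg_right h2 hx0.le
        _ = _ := by
          field_simp
    refine h1.trans ?_
    rw [Finset.prod_one_add, Finset.sum_mul]
    have hsub : x.primeFactors.powerset ⊆ Q.powerset := by
      refine Finset.powerset_mono.mpr fun p hp => ?_
      refine Finset.mem_filter.mpr ⟨Finset.mem_range.mpr ?_, Nat.prime_of_mem_primeFactors hp⟩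
      exact (Nat.le_of_mem_primeFactors hp).trans_lt hx.1
    refine le_trans (le_of_eq (Finset.sum_congr rfl fun t ht => ?_))
      (Finset.sum_le_sum_of_subset_of_nonneg hsub fun t _ _ => ?_)
    · rw [if_pos]
      exact (Finset.prod_dvd_prod_of_subset _ _ _ (Finset.mem_powerset.mp ht)).trans
        (Nat.prod_primeFactors_dvd x)
    · split_ifs
      · exact mul_nonneg (Finset.prod_nonneg fun _ _ => by positivity) (by positivity)
      · exact le_rfl
  refine (Finset.sum_le_sum hlocal).trans ?_
  rw [Finset.sum_comm]
  have hinner : ∀ t ∈ Q.powerset, ∑ x ∈ (Finset.range n).filter Squarefree,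
      (if (∏ q ∈ t, q) ∣ x then (∏ q ∈ t, (8 / q : ℝ)) * (x : ℝ)⁻¹ else 0) ≤
        (∏ q ∈ t, (8 / (q : ℝ) ^ 2)) * ∑ m ∈ Finset.Ico 1 n, (m : ℝ)⁻¹ := by
    intro t _
    rw [← Finset.sum_filter, ← Finset.mul_sum]
    have h1 : ∏ q ∈ t, (8 / (q : ℝ) ^ 2) =
        (∏ q ∈ t, (8 / q : ℝ)) * ((∏ q ∈ t, q : ℕ) : ℝ)⁻¹ := by
      push_cast
      rw [← Finset.prod_inv_distrib, ← Finset.prod_mul_distrib]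
      exact Finset.prod_congr rfl fun q _ => by rw [sq, div_mul_eq_div_div, div_eq_mul_inv (8 / _)]
    rw [h1, mul_assoc]
    refine mul_le_mul_of_nonneg_left ?_ (Finset.prod_nonneg fun _ _ => by positivity)
    refine le_trans (Finset.sum_le_sum_of_subset_of_nonneg ?_ fun _ _ _ => by positivity)
      (sum_inv_multiples_le _ n)
    intro x hx
    simp only [Finset.mem_filter, Finset.mem_range, Finset.mem_Ico] at hx ⊢
    exact ⟨⟨Nat.pos_of_ne_zero hx.1.2.ne_zero, hx.1.1⟩, hx.2⟩
  refine (Finset.sum_le_sum hinner).trans ?_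
  rw [← Finset.sum_mul, ← Finset.prod_one_add]
  have hlog : (0 : ℝ) ≤ Real.log n := Real.log_natCast_nonneg n
  refine mul_le_mul ?_ (sum_inv_Ico_le n) (Finset.sum_nonneg fun _ _ => by positivity)
    (Real.exp_pos 8).le
  calc ∏ q ∈ Q, (1 + 8 / (q : ℝ) ^ 2) ≤ ∏ q ∈ Q, Real.exp (8 / (q : ℝ) ^ 2) := by
        refine Finset.prod_le_prod (fun _ _ => by positivity) fun q _ => ?_
        rw [add_comm]
        exact Real.add_one_le_exp _
    _ = Real.exp (8 * ∑ q ∈ Q, ((q : ℝ) ^ 2)⁻¹) := by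
        rw [← Real.exp_sum, Finset.mul_sum]
        simp only [div_eq_mul_inv]
    _ ≤ Real.exp 8 := by
        refine Real.exp_le_exp.mpr ?_
        -- Primes exceed `1`, so the tail bound for `∑ 1 / q²` applies from there and gives exactly
        -- `1`.
        have h1 : ∑ q ∈ Q, ((q : ℝ) ^ 2)⁻¹ ≤ 2 / ((1 : ℕ) + 1) := by
          refine le_trans (Finset.sum_le_sum_of_subset_of_nonneg ?_ fun _ _ _ => by positivity)
            (sum_Ioo_inv_sq_le 1 n)
          intro q hq
          rw [Finset.mem_filter, Finset.mem_range] at hq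
          exact Finset.mem_Ioo.mpr ⟨hq.2.one_lt, hq.1⟩
        norm_num at h1
        linarith

/-- Both sides are Euler products over `p ∣ W`, and `p / (p - 1) = 1 + 1 / (p - 1) ≤ 1 + p / (p -
1)²`. -/
theorem div_totient_le_sum_divisors {W : ℕ} (hW : Squarefree W) :
    (W : ℝ) / W.totient ≤ ∑ l ∈ W.divisors, (l : ℝ) / (l.totient : ℝ) ^ 2 := by
  let f : ArithmeticFunction ℝ := ⟨fun n => (n : ℝ) / (n.totient : ℝ) ^ 2, by simp⟩
  have hf : f.IsMultiplicative := by
    refine ⟨by simp [f], fun {m n} h => ?_⟩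
    simp only [f, ArithmeticFunction.coe_mk]
    rw [Nat.totient_mul h]
    push_cast
    rw [mul_pow, mul_div_mul_comm]
  have h1 := hf.prodPrimeFactors_one_add_of_squarefree hW
  change _ ≤ ∑ l ∈ W.divisors, f l
  rw [← h1]
  have hW0 : (W : ℝ) ≠ 0 := by exact_mod_cast hW.ne_zero
  rw [totient_cast_eq, div_mul_eq_div_div, div_self hW0, one_div, ← Finset.prod_inv_distrib]
  refine Finset.prod_le_prod (fun p hp => ?_) fun p hp => ?_
  · have := inv_anti₀ (by norm_num) (two_le_cast_of_mem_primeFactors hp)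
    norm_num at this ⊢
    linarith
  · have hp2 := two_le_cast_of_mem_primeFactors hp
    have hp1 : (0 : ℝ) < p - 1 := by linarith
    have hp0 : (0 : ℝ) < p := by linarith
    simp only [f, ArithmeticFunction.coe_mk]
    rw [Nat.totient_prime (Nat.prime_of_mem_primeFactors hp)]
    push_cast [(Nat.prime_of_mem_primeFactors hp).one_le]
    have e1 : (1 - (p : ℝ)⁻¹)⁻¹ = 1 + 1 / (p - 1) := by
      field_simp
      ring
    rw [e1]
    have e2 : (p : ℝ) / (p - 1) ^ 2 - 1 / (p - 1) = 1 / (p - 1) ^ 2 := by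
      field_simp
      ring
    have e3 : 0 ≤ 1 / ((p : ℝ) - 1) ^ 2 := by positivity
    linarith

/-- The sum of `m / φ(m)²` over squarefree `m < n` coprime to `W`. -/
theorem sum_ratio_coprime_le {W : ℕ} (hW : Squarefree W) (n : ℕ) :
    ∑ m ∈ (Finset.range n).filter (fun m => Squarefree m ∧ Nat.Coprime m W),
      (m : ℝ) / (m.totient : ℝ) ^ 2 ≤
        (W.totient : ℝ) / W * (Real.exp 8 * (1 + Real.log ((W * n : ℕ) : ℝ))) := by
  set U := (Finset.range n).filter (fun m => Squarefree m ∧ Nat.Coprime m W) with hU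
  have hW0 : 0 < W := Nat.pos_of_ne_zero hW.ne_zero
  have hW0' : (0 : ℝ) < W := by exact_mod_cast hW0
  have hφ : (0 : ℝ) < W.totient := by exact_mod_cast Nat.totient_pos.mpr hW0
  -- The factor `l ∣ W` is recovered from `l m` as its gcd with `W`.
  have hinj : Set.InjOn (fun x : ℕ × ℕ => x.1 * x.2) (W.divisors ×ˢ U : Finset (ℕ × ℕ)) := by
    have hgcd : ∀ x ∈ (W.divisors ×ˢ U : Finset (ℕ × ℕ)), Nat.gcd (x.1 * x.2) W = x.1 := by
      intro x hx
      rw [Finset.mem_product, Nat.mem_divisors] at hx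
      rw [Nat.Coprime.gcd_mul_right_cancel _ (Finset.mem_filter.mp hx.2).2.2]
      exact Nat.gcd_eq_left hx.1.1
    intro x hx y hy h
    have h1 : x.1 = y.1 := by
      rw [← hgcd x hx, ← hgcd y hy]
      exact congrArg (Nat.gcd · W) h
    refine Prod.ext h1 ?_
    simp only [h1] at h
    rw [Finset.mem_coe, Finset.mem_product, Nat.mem_divisors] at hy
    exact Nat.eq_of_mul_eq_mul_left (Nat.pos_of_dvd_of_pos hy.1.1 hW0) h
  -- Multiplying by `W / φ(W)` restores the primes dividing `W`: the products `l m` are distinct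
  -- squarefree integers below `W n`. The price is `log (W n)` instead of `log n`.
  have hmul : (W : ℝ) / W.totient * ∑ m ∈ U, (m : ℝ) / (m.totient : ℝ) ^ 2 ≤
      Real.exp 8 * (1 + Real.log ((W * n : ℕ) : ℝ)) := by
    refine le_trans (mul_le_mul_of_nonneg_right (div_totient_le_sum_divisors hW)
      (Finset.sum_nonneg fun _ _ => by positivity)) ?_
    rw [Finset.sum_mul_sum, ← Finset.sum_product']
    refine le_trans (le_of_eq ?_) (le_trans (Finset.sum_le_sum_of_subset_of_nonneg
      (s := (W.divisors ×ˢ U).image fun x => x.1 * x.2)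
      (f := fun x : ℕ => (x : ℝ) / (x.totient : ℝ) ^ 2) ?_ fun _ _ _ => by positivity)
      (sum_ratio_squarefree_le (W * n)))
    · rw [Finset.sum_image hinj]
      refine Finset.sum_congr rfl fun x hx => ?_
      rw [Finset.mem_product, Nat.mem_divisors] at hx
      have hco : Nat.Coprime x.1 x.2 :=
        (Nat.Coprime.coprime_dvd_right hx.1.1 (Finset.mem_filter.mp hx.2).2.2).symm
      rw [Nat.totient_mul hco]
      push_cast
      rw [mul_pow, mul_div_mul_comm]
    · intro y hy
      obtain ⟨x, hx, rfl⟩ := Finset.mem_image.mp hy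
      rw [Finset.mem_product, Nat.mem_divisors] at hx
      have hx2 := Finset.mem_filter.mp hx.2
      have hco : Nat.Coprime x.1 x.2 := (Nat.Coprime.coprime_dvd_right hx.1.1 hx2.2.2).symm
      refine Finset.mem_filter.mpr ⟨Finset.mem_range.mpr ?_, ?_⟩
      · exact Nat.mul_lt_mul_of_le_of_lt (Nat.le_of_dvd hW0 hx.1.1) (Finset.mem_range.mp hx2.1) hW0
      · exact (Nat.squarefree_mul hco).mpr ⟨hW.squarefree_of_dvd hx.1.1, hx2.2.1⟩
  calc _ = (W.totient : ℝ) / W * ((W : ℝ) / W.totient *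
        ∑ m ∈ U, (m : ℝ) / (m.totient : ℝ) ^ 2) := by
        field_simp
    _ ≤ _ := by gcongr

/-- Harmonic sums are `O(x ^ ε)`. -/
theorem exists_sum_inv_le {ε : ℝ} (hε : 0 < ε) :
    ∃ C : ℝ, 1 ≤ C ∧ ∀ x : ℝ, 1 ≤ x →
      ∑ m ∈ Finset.Ico 1 ⌈x⌉₊, (m : ℝ)⁻¹ ≤ C * x ^ ε := by
  refine ⟨2 + 1 / ε, by have : 0 < 1 / ε := by positivity
                        linarith, fun x hx => ?_⟩
  have hc : (⌈x⌉₊ : ℝ) ≤ 2 * x := by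
    have := Nat.ceil_lt_add_one (by linarith : 0 ≤ x)
    linarith
  have hpos : (0 : ℝ) < ⌈x⌉₊ := by exact_mod_cast Nat.ceil_pos.mpr (by linarith)
  have h1 : Real.log ⌈x⌉₊ ≤ Real.log 2 + Real.log x := by
    rw [← Real.log_mul (by norm_num) (by linarith)]
    exact Real.log_le_log hpos hc
  have h2 : Real.log 2 ≤ 1 := by
    have := Real.log_two_lt_d9
    linarith
  have h3 : Real.log x ≤ x ^ ε / ε := Real.log_le_rpow_div (by linarith) hε
  have h4 : 1 ≤ x ^ ε := Real.one_le_rpow hx hε.le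
  have h5 := sum_inv_Ico_le ⌈x⌉₊
  calc _ ≤ 2 + x ^ ε / ε := by linarith
    _ ≤ 2 * x ^ ε + x ^ ε / ε := by linarith
    _ = _ := by ring

/-! ### Crude bounds for the sieve weights -/

/-- The divisor bound replaces `1 / φ(r)` by `R^(ε/2) / r` up to a constant; summing over multiples
of `d` then cancels the factor `d`. -/
theorem exists_sum_div_totient_le {ε : ℝ} (hε : 0 < ε) :
    ∃ C : ℝ, 1 ≤ C ∧ ∀ R : ℝ, 1 ≤ R → ∀ d : ℕ,
      ∑ r ∈ (Finset.Ico 1 ⌈R⌉₊).filter (d ∣ ·), (d : ℝ) / r.totient ≤ C * R ^ ε := by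
  obtain ⟨C₁, hC₁, h₁⟩ := exists_two_pow_card_primeFactors_le (half_pos hε)
  obtain ⟨C₂, hC₂, h₂⟩ := exists_sum_inv_le (half_pos hε)
  refine ⟨C₁ * C₂, one_le_mul_of_one_le_of_one_le hC₁ hC₂, fun R hR d => ?_⟩
  have hR0 : 0 < R := by linarith
  calc _ ≤ ∑ r ∈ (Finset.Ico 1 ⌈R⌉₊).filter (d ∣ ·), d * (C₁ * R ^ (ε / 2)) * (r : ℝ)⁻¹ := by
        refine Finset.sum_le_sum fun r hr => ?_
        simp only [Finset.mem_filter, Finset.mem_Ico] at hr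
        have hr0 : (0 : ℝ) < r := by exact_mod_cast hr.1.1
        have hφ : (0 : ℝ) < r.totient := by exact_mod_cast Nat.totient_pos.mpr hr.1.1
        have hrR : (r : ℝ) < R := Nat.lt_ceil.mp hr.1.2
        have h3 : (r : ℝ) ≤ C₁ * R ^ (ε / 2) * r.totient := by
          refine (le_two_pow_mul_totient r).trans (mul_le_mul_of_nonneg_right ?_ hφ.le)
          refine (h₁ r (by omega)).trans (mul_le_mul_of_nonneg_left ?_ (by linarith))
          exact Real.rpow_le_rpow hr0.le hrR.le (by linarith)
        rw [mul_assoc, div_eq_mul_inv]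
        refine mul_le_mul_of_nonneg_left ?_ (Nat.cast_nonneg d)
        rw [← div_eq_mul_inv, inv_eq_one_div, div_le_div_iff₀ hφ hr0, one_mul]
        exact h3
    _ ≤ d * (C₁ * R ^ (ε / 2)) * ((d : ℝ)⁻¹ * ∑ m ∈ Finset.Ico 1 ⌈R⌉₊, (m : ℝ)⁻¹) := by
        rw [← Finset.mul_sum]
        exact mul_le_mul_of_nonneg_left (sum_inv_multiples_le d _) (by positivity)
    _ = (d * (d : ℝ)⁻¹) * ((C₁ * R ^ (ε / 2)) * ∑ m ∈ Finset.Ico 1 ⌈R⌉₊, (m : ℝ)⁻¹) := by ring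
    _ ≤ 1 * ((C₁ * R ^ (ε / 2)) * (C₂ * R ^ (ε / 2))) := by
        refine mul_le_mul (mul_inv_le_one) (mul_le_mul_of_nonneg_left (h₂ R hR) (by positivity))
          (mul_nonneg (by positivity) (Finset.sum_nonneg fun _ _ => by positivity)) zero_le_one
    _ = C₁ * C₂ * (R ^ (ε / 2) * R ^ (ε / 2)) := by ring
    _ = _ := by rw [← Real.rpow_add hR0, add_halves]

/-- Division by `k + 1` instead of `k` avoids a separate case `k = 0` when `ε` is shared among `k`
coordinates. -/
theorem rpow_div_pow_le {x ε : ℝ} (hx : 1 ≤ x) (hε : 0 < ε) (k : ℕ) :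
    (x ^ (ε / (k + 1))) ^ k ≤ x ^ ε := by
  rw [← Real.rpow_mul_natCast (by linarith)]
  refine Real.rpow_le_rpow_of_exponent_le hx ?_
  rw [div_mul_eq_mul_div, div_le_iff₀ (by positivity)]
  nlinarith

section Crude

variable {k : ℕ}

theorem pos_of_yWeight_ne_zero {F : (Fin k → ℝ) → ℝ} {W : ℕ} {R : ℝ} {r : Fin k → ℕ}
    (h : yWeight F W R r ≠ 0) (i : Fin k) : 0 < r i :=
  Nat.pos_of_ne_zero fun h0 => (yWeight_conditions h).1.ne_zero
    (Finset.prod_eq_zero (Finset.mem_univ i) h0)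

/-- After bounding `|y|` by `M` and `|μ|` by `1`, the sum over `r` factors into `k` one-variable
sums over multiples of `d i`. -/
theorem exists_abs_lamWeight_le (k : ℕ) {ε : ℝ} (hε : 0 < ε) :
    ∃ C : ℝ, 1 ≤ C ∧ ∀ (F : (Fin k → ℝ) → ℝ) (W : ℕ) (R M : ℝ), 1 ≤ R →
      (∀ r, |yWeight F W R r| ≤ M) → ∀ d, |lamWeight F W R d| ≤ C * M * R ^ ε := by
  obtain ⟨C, hC, h⟩ := exists_sum_div_totient_le (ε := ε / (k + 1)) (by positivity)
  refine ⟨C ^ k, one_le_pow₀ hC, fun F W R M hR hM d => ?_⟩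
  have hM0 : 0 ≤ M := (abs_nonneg _).trans (hM fun _ => 0)
  unfold lamWeight
  rw [abs_mul, Finset.abs_prod]
  have h1 : ∏ i, |((ArithmeticFunction.moebius (d i) : ℤ) : ℝ) * (d i : ℝ)| ≤
      ∏ i, (d i : ℝ) := by
    refine Finset.prod_le_prod (fun _ _ => abs_nonneg _) fun i _ => ?_
    rw [abs_mul, Nat.abs_cast]
    have : |((ArithmeticFunction.moebius (d i) : ℤ) : ℝ)| ≤ 1 := by
      exact_mod_cast ArithmeticFunction.abs_moebius_le_one (n := d i)
    exact mul_le_of_le_one_left (Nat.cast_nonneg _) this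
  classical
  have h2 : |∑ r ∈ (box k R).filter (fun r => ∀ i, d i ∣ r i),
      yWeight F W R r / ∏ i, (Nat.totient (r i) : ℝ)| ≤
      ∑ r ∈ Fintype.piFinset fun i => (Finset.Ico 1 ⌈R⌉₊).filter (d i ∣ ·),
        M * ∏ i, ((r i).totient : ℝ)⁻¹ := by
    refine (Finset.abs_sum_le_sum_abs _ _).trans ?_
    have h3 : ∀ r ∈ (box k R).filter (fun r => ∀ i, d i ∣ r i),
        |yWeight F W R r / ∏ i, (Nat.totient (r i) : ℝ)| ≤
        if r ∈ Fintype.piFinset fun i => (Finset.Ico 1 ⌈R⌉₊).filter (d i ∣ ·) then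
          M * ∏ i, ((r i).totient : ℝ)⁻¹ else 0 := by
      intro r hr
      rw [Finset.mem_filter] at hr
      by_cases hy : yWeight F W R r = 0
      · rw [hy, zero_div, abs_zero]
        split_ifs
        · exact mul_nonneg hM0 (Finset.prod_nonneg fun _ _ => by positivity)
        · exact le_rfl
      · rw [if_pos, abs_div, div_eq_mul_inv, Finset.prod_inv_distrib,
          Finset.abs_prod]
        · simp only [Nat.abs_cast]
          exact mul_le_mul_of_nonneg_right (hM r)
            (inv_nonneg.mpr (Finset.prod_nonneg fun _ _ => Nat.cast_nonneg _))
        · have hb := hr.1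
          simp only [box, Fintype.mem_piFinset, Finset.mem_range] at hb
          refine Fintype.mem_piFinset.mpr fun i => Finset.mem_filter.mpr ⟨?_, hr.2 i⟩
          exact Finset.mem_Ico.mpr ⟨pos_of_yWeight_ne_zero hy i, hb i⟩
    refine (Finset.sum_le_sum h3).trans ?_
    rw [Finset.sum_ite_mem]
    exact Finset.sum_le_sum_of_subset_of_nonneg Finset.inter_subset_right fun _ _ _ =>
      mul_nonneg hM0 (Finset.prod_nonneg fun _ _ => by positivity)
  have h4 : (∏ i, (d i : ℝ)) * ∑ r ∈ Fintype.piFinset fun i =>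
      (Finset.Ico 1 ⌈R⌉₊).filter (d i ∣ ·), M * ∏ i, ((r i).totient : ℝ)⁻¹ =
      M * ∏ i, ∑ r ∈ (Finset.Ico 1 ⌈R⌉₊).filter (d i ∣ ·), (d i : ℝ) / r.totient := by
    rw [Finset.prod_univ_sum, Finset.mul_sum, Finset.mul_sum]
    refine Finset.sum_congr rfl fun r _ => ?_
    simp only [div_eq_mul_inv, Finset.prod_mul_distrib]
    ring
  calc _ ≤ (∏ i, (d i : ℝ)) * ∑ r ∈ Fintype.piFinset fun i =>
        (Finset.Ico 1 ⌈R⌉₊).filter (d i ∣ ·), M * ∏ i, ((r i).totient : ℝ)⁻¹ :=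
        mul_le_mul h1 h2 (abs_nonneg _) (Finset.prod_nonneg fun _ _ => Nat.cast_nonneg _)
    _ ≤ M * ∏ _i : Fin k, (C * R ^ (ε / (k + 1))) := by
        rw [h4]
        refine mul_le_mul_of_nonneg_left ?_ hM0
        exact Finset.prod_le_prod (fun i _ => Finset.sum_nonneg fun _ _ => by positivity)
          fun i _ => h R hR (d i)
    _ = C ^ k * M * (R ^ (ε / (k + 1))) ^ k := by
        rw [Finset.prod_const, Finset.card_univ, Fintype.card_fin, mul_pow]
        ring
    _ ≤ _ := mul_le_mul_of_nonneg_left (rpow_div_pow_le hR hε k) (by positivity)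

/-- Rankin's trick: if `λ_d ≠ 0` then `∏ d_i ≤ ∏ r_i ≤ D`, so inserting the factor `D ∏ d_i⁻¹ ≥ 1`
turns the sum into a product of harmonic sums. -/
theorem exists_sum_abs_lamWeight_le (k : ℕ) {ε : ℝ} (hε : 0 < ε) :
    ∃ C : ℝ, 1 ≤ C ∧ ∀ (F : (Fin k → ℝ) → ℝ) (W : ℕ) (R M D : ℝ), 1 ≤ R → 0 ≤ D →
      (∀ r, |yWeight F W R r| ≤ M) →
      (∀ r, yWeight F W R r ≠ 0 → ((∏ i, r i : ℕ) : ℝ) ≤ D) →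
      ∑ d ∈ box k R, |lamWeight F W R d| ≤ C * M * D * R ^ ε := by
  obtain ⟨C₁, hC₁, h₁⟩ := exists_abs_lamWeight_le k (half_pos hε)
  obtain ⟨C₂, hC₂, h₂⟩ := exists_sum_inv_le (ε := ε / 2 / (k + 1)) (by positivity)
  refine ⟨C₁ * C₂ ^ k, one_le_mul_of_one_le_of_one_le hC₁ (one_le_pow₀ hC₂),
    fun F W R M D hR hD0 hM hD => ?_⟩
  have hM0 : 0 ≤ M := (abs_nonneg _).trans (hM fun _ => 0)
  have hR0 : 0 < R := by linarith
  have hterm : ∀ d ∈ box k R, |lamWeight F W R d| ≤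
      if d ∈ Fintype.piFinset fun _ : Fin k => Finset.Ico 1 ⌈R⌉₊ then
        C₁ * M * R ^ (ε / 2) * D * ∏ i, (d i : ℝ)⁻¹ else 0 := by
    intro d hd
    by_cases hl : lamWeight F W R d = 0
    · rw [hl, abs_zero]
      split_ifs
      · exact mul_nonneg (by positivity) (Finset.prod_nonneg fun _ _ => by positivity)
      · exact le_rfl
    · obtain ⟨r, -, hdr, hy⟩ := exists_yWeight_of_lamWeight hl
      have hpos : ∀ i, 0 < d i := fun i =>
        Nat.pos_of_dvd_of_pos (hdr i) (pos_of_yWeight_ne_zero hy i)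
      have hprod : 1 ≤ D * ∏ i, (d i : ℝ)⁻¹ := by
        have h3 : (0 : ℝ) < ∏ i, (d i : ℝ) := Finset.prod_pos fun i _ => by exact_mod_cast hpos i
        rw [Finset.prod_inv_distrib, ← div_eq_mul_inv, one_le_div h3]
        refine le_trans ?_ (hD r hy)
        rw [← Nat.cast_prod]
        exact Nat.cast_le.mpr (Nat.le_of_dvd
          (Finset.prod_pos fun i _ => pos_of_yWeight_ne_zero hy i)
          (Finset.prod_dvd_prod_of_dvd _ _ fun i _ => hdr i))
      rw [if_pos]
      · rw [mul_assoc (C₁ * M * R ^ (ε / 2))]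
        refine (h₁ F W R M hR hM d).trans (le_mul_of_one_le_right (by positivity) hprod)
      · simp only [box, Fintype.mem_piFinset, Finset.mem_range] at hd
        exact Fintype.mem_piFinset.mpr fun i => Finset.mem_Ico.mpr ⟨hpos i, hd i⟩
  refine (Finset.sum_le_sum hterm).trans ?_
  rw [Finset.sum_ite_mem]
  calc _ ≤ ∑ d ∈ Fintype.piFinset fun _ : Fin k => Finset.Ico 1 ⌈R⌉₊,
        C₁ * M * R ^ (ε / 2) * D * ∏ i, (d i : ℝ)⁻¹ :=
        Finset.sum_le_sum_of_subset_of_nonneg Finset.inter_subset_right fun _ _ _ =>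
          mul_nonneg (by positivity) (Finset.prod_nonneg fun _ _ => by positivity)
    _ = C₁ * M * R ^ (ε / 2) * D * (∑ m ∈ Finset.Ico 1 ⌈R⌉₊, (m : ℝ)⁻¹) ^ k := by
        rw [← Finset.mul_sum, ← Finset.prod_univ_sum (fun _ : Fin k => Finset.Ico 1 ⌈R⌉₊)
          (fun _ m => (m : ℝ)⁻¹), Finset.prod_const, Finset.card_univ, Fintype.card_fin]
    _ ≤ C₁ * M * R ^ (ε / 2) * D * (C₂ ^ k * R ^ (ε / 2)) := by
        refine mul_le_mul_of_nonneg_left ?_ (by positivity)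
        refine (pow_le_pow_left₀ (Finset.sum_nonneg fun _ _ => by positivity) (h₂ R hR) k).trans ?_
        rw [mul_pow]
        exact mul_le_mul_of_nonneg_left (rpow_div_pow_le hR (half_pos hε) k) (by positivity)
    _ = C₁ * C₂ ^ k * M * D * (R ^ (ε / 2) * R ^ (ε / 2)) := by ring
    _ = _ := by rw [← Real.rpow_add hR0, add_halves]

theorem selbergSq_le_sq_sum_abs (A : Fin k → ℕ) (B : Fin k → ℤ) (F : (Fin k → ℝ) → ℝ) (W : ℕ)
    (R : ℝ) (n : ℤ) : selbergSq A B F W R n ≤ (∑ d ∈ box k R, |lamWeight F W R d|) ^ 2 := by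
  unfold selbergSq
  rw [← sq_abs]
  refine pow_le_pow_left₀ (abs_nonneg _) ((Finset.abs_sum_le_sum_abs _ _).trans ?_) 2
  exact Finset.sum_le_sum_of_subset_of_nonneg (Finset.filter_subset _ _) fun _ _ _ => abs_nonneg _

theorem selbergSq_nonneg (A : Fin k → ℕ) (B : Fin k → ℤ) (F : (Fin k → ℝ) → ℝ) (W : ℕ)
    (R : ℝ) (n : ℤ) : 0 ≤ selbergSq A B F W R n := sq_nonneg _

theorem card_divisors_filter_squarefree_le (n : ℕ) :
    ((n.divisors.filter Squarefree).card : ℝ) ≤ 2 ^ n.primeFactors.card := by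
  have h : (n.divisors.filter Squarefree).card ≤ n.primeFactors.powerset.card := by
    refine Finset.card_le_card_of_injOn Nat.primeFactors (fun d hd => ?_) fun d hd e he h => ?_
    · rw [Finset.mem_coe, Finset.mem_filter, Nat.mem_divisors] at hd
      exact Finset.mem_coe.mpr (Finset.mem_powerset.mpr (Nat.primeFactors_mono hd.1.1 hd.1.2))
    · rw [Finset.mem_coe, Finset.mem_filter] at hd he
      rw [← Nat.prod_primeFactors_of_squarefree hd.2, ← Nat.prod_primeFactors_of_squarefree he.2, h]
  rw [Finset.card_powerset] at h
  exact_mod_cast h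

/-- Only tuples of squarefree divisors of the nonzero values `L_i(n)` have `λ ≠ 0`. There are at
most `∏ 2^ω(L_i(n))` of them, and each weight obeys the pointwise bound. -/
theorem exists_selbergSq_le (k : ℕ) {ε : ℝ} (hε : 0 < ε) :
    ∃ C : ℝ, 1 ≤ C ∧ ∀ (A : Fin k → ℕ) (B : Fin k → ℤ) (F : (Fin k → ℝ) → ℝ) (W : ℕ)
      (R M Y : ℝ) (n : ℤ), 1 ≤ R → R ≤ Y → (∀ r, |yWeight F W R r| ≤ M) →
      (∀ i, linForm A B i n ≠ 0) → (∀ i, ((linForm A B i n).natAbs : ℝ) ≤ Y) →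
      selbergSq A B F W R n ≤ C * M ^ 2 * Y ^ ε := by
  obtain ⟨C₁, hC₁, h₁⟩ := exists_abs_lamWeight_le k (ε := ε / 4) (by positivity)
  obtain ⟨C₂, hC₂, h₂⟩ := exists_two_pow_card_primeFactors_le (ε := ε / 4 / (k + 1))
    (by positivity)
  refine ⟨(C₁ * C₂ ^ k) ^ 2, one_le_pow₀ (one_le_mul_of_one_le_of_one_le hC₁ (one_le_pow₀ hC₂)),
    fun A B F W R M Y n hR hRY hM hne hY => ?_⟩
  have hM0 : 0 ≤ M := (abs_nonneg _).trans (hM fun _ => 0)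
  have hR0 : 0 < R := by linarith
  have hY1 : 1 ≤ Y := hR.trans hRY
  have hY0 : 0 < Y := by linarith
  unfold selbergSq
  have habs : |∑ d ∈ (box k R).filter (fun d => ∀ i, (d i : ℤ) ∣ linForm A B i n),
      lamWeight F W R d| ≤ C₁ * C₂ ^ k * M * Y ^ (ε / 2) := by
    refine (Finset.abs_sum_le_sum_abs _ _).trans ?_
    set T := Fintype.piFinset fun i => (linForm A B i n).natAbs.divisors.filter Squarefree with hT
    have hterm : ∀ d ∈ (box k R).filter (fun d => ∀ i, (d i : ℤ) ∣ linForm A B i n),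
        |lamWeight F W R d| ≤ if d ∈ T then C₁ * M * Y ^ (ε / 4) else 0 := by
      intro d hd
      rw [Finset.mem_filter] at hd
      by_cases hl : lamWeight F W R d = 0
      · rw [hl, abs_zero]
        split_ifs
        · positivity
        · exact le_rfl
      · rw [if_pos]
        · refine (h₁ F W R M hR hM d).trans (mul_le_mul_of_nonneg_left ?_ (by positivity))
          exact Real.rpow_le_rpow hR0.le hRY (by positivity)
        · obtain ⟨r, -, hdr, hy⟩ := exists_yWeight_of_lamWeight hl
          refine Fintype.mem_piFinset.mpr fun i => Finset.mem_filter.mpr ⟨?_, ?_⟩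
          · exact Nat.mem_divisors.mpr ⟨Int.natCast_dvd.mp (hd.2 i), Int.natAbs_ne_zero.mpr (hne i)⟩
          · exact (yWeight_conditions hy).1.squarefree_of_dvd
              ((hdr i).trans (Finset.dvd_prod_of_mem r (Finset.mem_univ i)))
    refine (Finset.sum_le_sum hterm).trans ?_
    rw [Finset.sum_ite_mem]
    have hcard : (T.card : ℝ) ≤ C₂ ^ k * Y ^ (ε / 4) := by
      rw [hT, Fintype.card_piFinset, Nat.cast_prod]
      calc _ ≤ ∏ _i : Fin k, (C₂ * Y ^ (ε / 4 / (k + 1))) := by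
            refine Finset.prod_le_prod (fun _ _ => Nat.cast_nonneg _) fun i _ => ?_
            refine (card_divisors_filter_squarefree_le _).trans
              ((h₂ _ (Int.natAbs_ne_zero.mpr (hne i))).trans ?_)
            exact mul_le_mul_of_nonneg_left
              (Real.rpow_le_rpow (Nat.cast_nonneg _) (hY i) (by positivity)) (by linarith)
        _ = C₂ ^ k * (Y ^ (ε / 4 / (k + 1))) ^ k := by
            rw [Finset.prod_const, Finset.card_univ, Fintype.card_fin, mul_pow]
        _ ≤ _ := mul_le_mul_of_nonneg_left (rpow_div_pow_le hY1 (by positivity) k) (by positivity)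
    calc _ ≤ ∑ _d ∈ T, C₁ * M * Y ^ (ε / 4) :=
          Finset.sum_le_sum_of_subset_of_nonneg Finset.inter_subset_right fun _ _ _ => by positivity
      _ = T.card * (C₁ * M * Y ^ (ε / 4)) := by rw [Finset.sum_const, nsmul_eq_mul]
      _ ≤ (C₂ ^ k * Y ^ (ε / 4)) * (C₁ * M * Y ^ (ε / 4)) :=
          mul_le_mul_of_nonneg_right hcard (by positivity)
      _ = C₁ * C₂ ^ k * M * (Y ^ (ε / 4) * Y ^ (ε / 4)) := by ring
      _ = _ := by
        rw [← Real.rpow_add hY0]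
        congr 2
        ring
  rw [← sq_abs]
  refine (pow_le_pow_left₀ (abs_nonneg _) habs 2).trans (le_of_eq ?_)
  rw [mul_pow, mul_pow, ← Real.rpow_natCast (Y ^ (ε / 2)) 2, ← Real.rpow_mul hY0.le]
  congr 2
  push_cast
  ring

end Crude

/-! ### The modulus `W` -/

theorem one_lt_log_of_sixteen_lt {N : ℝ} (hN : 16 < N) : 1 < Real.log N := by
  rw [Real.lt_log_iff_exp_lt (by linarith)]
  have := Real.exp_one_lt_d9
  linarith

theorem prime_dvd_W_iff {N : ℝ} {q : ℕ} (hq : q.Prime) : q ∣ W N ↔ (q : ℝ) < D0 N := by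
  unfold W
  rw [hq.prime.dvd_finsetProd_iff]
  constructor
  · rintro ⟨p, hp, hd⟩
    rw [Finset.mem_filter, Finset.mem_range] at hp
    rw [Nat.prime_dvd_prime_iff_eq hq hp.2] at hd
    exact hd ▸ Nat.lt_ceil.mp hp.1
  · intro h
    exact ⟨q, Finset.mem_filter.mpr ⟨Finset.mem_range.mpr (Nat.lt_ceil.mpr h), hq⟩, dvd_rfl⟩

theorem squarefree_W (N : ℝ) : Squarefree (W N) :=
  Finset.squarefree_prod_of_pairwise_isCoprime
    (fun _ hp _ hq h => Nat.coprime_iff_isRelPrime.mp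
      ((Nat.coprime_primes (Finset.mem_filter.mp hp).2 (Finset.mem_filter.mp hq).2).mpr h))
    fun _ hp => (Finset.mem_filter.mp hp).2.prime.squarefree

theorem W_pos (N : ℝ) : 0 < W N := Nat.pos_of_ne_zero (squarefree_W N).ne_zero

theorem exp_D0 {N : ℝ} (hN : 16 < N) : Real.exp (D0 N) = Real.log (Real.log N) :=
  Real.exp_log (Real.log_pos (one_lt_log_of_sixteen_lt hN))

theorem D0_le_log {N : ℝ} (hN : 16 < N) : D0 N ≤ Real.log N := by
  have h := one_lt_log_of_sixteen_lt hN
  have h1 := Real.add_one_le_exp (D0 N)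
  rw [exp_D0 hN] at h1
  have h2 := Real.log_le_sub_one_of_pos (by linarith : 0 < Real.log N)
  linarith

/-- Chebyshev's bound gives `W ≤ 4 ^ ⌈D₀⌉`, with `4 ≤ e²`, `⌈D₀⌉ ≤ D₀ + 1` and `e ^ D₀ = log log N`.
-/
theorem W_le {N : ℝ} (hN : 16 < N) (hD : 0 < D0 N) :
    (W N : ℝ) ≤ Real.exp 2 * Real.log N ^ 2 := by
  have h1 : W N ≤ 4 ^ ⌈D0 N⌉₊ := by
    refine le_trans ?_ (primorial_le_four_pow ⌈D0 N⌉₊)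
    refine Nat.le_of_dvd (primorial_pos _) ?_
    unfold W
    refine Finset.prod_primes_dvd _ (fun p hp => (Finset.mem_filter.mp hp).2.prime) fun p hp => ?_
    rw [Finset.mem_filter, Finset.mem_range] at hp
    exact (hp.2.dvd_primorial_iff).mpr hp.1.le
  have hlog := one_lt_log_of_sixteen_lt hN
  have hll : Real.log (Real.log N) ≤ Real.log N := by
    have := Real.log_le_sub_one_of_pos (by linarith : 0 < Real.log N)
    linarith
  have hc : (⌈D0 N⌉₊ : ℝ) ≤ D0 N + 1 := (Nat.ceil_lt_add_one hD.le).le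
  have h4 : (4 : ℝ) ≤ Real.exp 2 := by
    have h := Real.add_one_le_exp (1 : ℝ)
    calc (4 : ℝ) ≤ Real.exp 1 * Real.exp 1 := by nlinarith
      _ = Real.exp 2 := by
        rw [← Real.exp_add]
        norm_num
  calc (W N : ℝ) ≤ 4 ^ ⌈D0 N⌉₊ := by exact_mod_cast h1
    _ ≤ Real.exp 2 ^ ⌈D0 N⌉₊ := pow_le_pow_left₀ (by norm_num) h4 _
    _ = Real.exp (⌈D0 N⌉₊ * 2) := (Real.exp_nat_mul 2 _).symm
    _ ≤ Real.exp (2 + (D0 N + D0 N)) := Real.exp_le_exp.mpr (by linarith)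
    _ = Real.exp 2 * Real.log (Real.log N) ^ 2 := by
        rw [Real.exp_add, Real.exp_add, exp_D0 hN, sq]
    _ ≤ _ := by
        refine mul_le_mul_of_nonneg_left ?_ (Real.exp_pos 2).le
        exact pow_le_pow_left₀ (Real.log_nonneg hlog.le) hll 2

/-! ### Consequences of admissibility -/

section Admissible

variable {k : ℕ} {A : Fin k → ℕ} {B : Fin k → ℤ}

/-- A common prime factor of `A i` and `B i` would divide every value of the form, making all
residues roots. -/
theorem Admissible.isCoprime (h : Admissible A B) (i : Fin k) : IsCoprime (A i : ℤ) (B i) := by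
  rw [Int.isCoprime_iff_gcd_eq_one]
  by_contra hg
  obtain ⟨p, hp, hpd⟩ := Nat.exists_prime_and_dvd hg
  have hpA : (p : ℤ) ∣ A i := (Int.natCast_dvd_natCast.mpr hpd).trans (Int.gcd_dvd_left _ _)
  have hpB : (p : ℤ) ∣ B i := (Int.natCast_dvd_natCast.mpr hpd).trans (Int.gcd_dvd_right _ _)
  have h1 := h.1 p hp
  unfold rootCount at h1
  rw [Finset.filter_true_of_mem] at h1
  · simp at h1
  · intro n _
    refine dvd_trans ?_ (Finset.dvd_prod_of_mem _ (Finset.mem_univ i))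
    exact dvd_add (hpA.mul_right _) hpB

/-- A vanishing resultant makes two primitive forms with positive leading coefficients proportional,
hence equal. -/
theorem Admissible.det_ne_zero (h : Admissible A B) (hA : ∀ i, 0 < A i) {i j : Fin k}
    (hij : i ≠ j) : (A i : ℤ) * B j - (A j : ℤ) * B i ≠ 0 := by
  intro h0
  have h1 : (A i : ℤ) * B j = A j * B i := sub_eq_zero.mp h0
  have h2 : (A i : ℤ) ∣ A j := (h.isCoprime i).dvd_of_dvd_mul_right ⟨B j, h1.symm⟩
  have h3 : (A j : ℤ) ∣ A i := (h.isCoprime j).dvd_of_dvd_mul_right ⟨B i, h1⟩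
  have h4 : A i = A j := Nat.dvd_antisymm (Int.natCast_dvd_natCast.mp h2)
    (Int.natCast_dvd_natCast.mp h3)
  refine h.2 i j hij (Prod.ext h4 ?_)
  rw [h4] at h1
  exact (mul_left_cancel₀ (by exact_mod_cast (hA j).ne') h1).symm

/-- The one-sided resultant bound applied to `(i, j)` and `(j, i)` bounds the absolute value by `D₀
≤ q`; a multiple of `q` that small is zero. -/
theorem isGoodPrime_of_not_dvd_W (h : Admissible A B) (hA : ∀ i, 0 < A i) {N : ℝ}
    (hAD : ∀ i, (A i : ℝ) < D0 N)
    (hdet : ∀ i j, (A i : ℝ) * (B j : ℝ) - (A j : ℝ) * (B i : ℝ) < D0 N)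
    {q : ℕ} (hq : q.Prime) (hqW : ¬ q ∣ W N) : IsGoodPrime A B q := by
  rw [prime_dvd_W_iff hq, not_lt] at hqW
  refine ⟨hq, fun i hd => ?_, fun i j hij hd => h.det_ne_zero hA hij ?_⟩
  · have h1 : (q : ℝ) ≤ A i := by exact_mod_cast Nat.le_of_dvd (hA i) hd
    linarith [hAD i]
  · have h1 : ((A i : ℤ) * B j - (A j : ℤ) * B i : ℤ) < q := by
      have := (hdet i j).trans_le hqW
      exact_mod_cast this
    have h2 : ((A j : ℤ) * B i - (A i : ℤ) * B j : ℤ) < q := by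
      have := (hdet j i).trans_le hqW
      exact_mod_cast this
    refine Int.eq_zero_of_abs_lt_dvd hd ?_
    rw [abs_lt]
    constructor <;> linarith

/-- If `P(n)` is coprime to `W` and not squarefree then some `L_j(n)` is divisible by the square of a
prime not dividing `W`. -/
theorem exists_prime_sq_dvd_linForm {W : ℕ} {n : ℤ} (hco : IsCoprime (formProd A B n) (W : ℤ))
    (hgood : ∀ q : ℕ, q.Prime → ¬ q ∣ W → IsGoodPrime A B q)
    (hsq : ¬ Squarefree (formProd A B n)) :
    ∃ (j : Fin k) (p : ℕ), p.Prime ∧ ¬ p ∣ W ∧ (p : ℤ) ^ 2 ∣ linForm A B j n := by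
  rw [← Int.squarefree_natAbs, Nat.squarefree_iff_prime_squarefree] at hsq
  push Not at hsq
  obtain ⟨p, hp, hd⟩ := hsq
  have hd' : (p : ℤ) ^ 2 ∣ formProd A B n := by
    rw [sq]
    exact_mod_cast Int.natCast_dvd.mpr hd
  have hpd : (p : ℤ) ∣ formProd A B n := (dvd_pow_self _ two_ne_zero).trans hd'
  have hpp : Prime (p : ℤ) := Nat.prime_iff_prime_int.mp hp
  have hpW : ¬ p ∣ W := fun h =>
    hpp.not_isUnit (hco.isUnit_of_dvd' hpd (Int.natCast_dvd_natCast.mpr h))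
  have hg := hgood p hp hpW
  obtain ⟨j, -, hj⟩ := (hpp.dvd_finsetProd_iff _).mp hpd
  refine ⟨j, p, hp, hpW, ?_⟩
  unfold formProd at hd'
  rw [← Finset.mul_prod_erase _ _ (Finset.mem_univ j)] at hd'
  -- A good prime dividing `L_j(n)` is coprime to the other factors, so all of `p²` divides
  -- `L_j(n)`.
  refine IsCoprime.dvd_of_dvd_mul_right ?_ hd'
  refine IsCoprime.pow_left (IsCoprime.prod_right fun i hi => ?_)
  refine (Prime.coprime_iff_not_dvd hpp).mpr fun h => ?_
  exact Finset.ne_of_mem_erase hi (hg.eq_of_dvd h hj)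

theorem isCoprime_formProd_of_modEq {W : ℕ} {n ν₀ : ℤ} (h : n ≡ ν₀ [ZMOD (W : ℤ)])
    (hco : IsCoprime (formProd A B ν₀) (W : ℤ)) : IsCoprime (formProd A B n) (W : ℤ) := by
  have h1 : formProd A B n ≡ formProd A B ν₀ [ZMOD (W : ℤ)] := by
    unfold formProd linForm
    exact Int.ModEq.prod fun i _ => (h.mul_left _).add_right _
  obtain ⟨t, ht⟩ := h1.dvd
  rw [show formProd A B n = formProd A B ν₀ + W * (-t) by linear_combination -ht]
  exact hco.add_mul_left_left _

end Admissible

/-! ### Splitting the sum -/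

theorem sum_le_sum_cover {α β : Type*} (s : Finset α) (t : Finset β)
    (u : β → Finset α) (f : α → ℝ) (hf : ∀ a, 0 ≤ f a) (h : ∀ a ∈ s, ∃ b ∈ t, a ∈ u b) :
    ∑ a ∈ s, f a ≤ ∑ b ∈ t, ∑ a ∈ u b, f a := by
  classical
  have h1 : ∀ a ∈ s, f a ≤ ∑ b ∈ t, if a ∈ u b then f a else 0 := by
    intro a ha
    obtain ⟨b, hb, hab⟩ := h a ha
    calc f a = if a ∈ u b then f a else 0 := (if_pos hab).symm
      _ ≤ _ := Finset.single_le_sum (f := fun b => if a ∈ u b then f a else 0)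
        (fun b _ => by split_ifs; exacts [hf a, le_rfl]) hb
  refine (Finset.sum_le_sum h1).trans ?_
  rw [Finset.sum_comm]
  refine Finset.sum_le_sum fun b _ => ?_
  rw [Finset.sum_ite_mem]
  exact Finset.sum_le_sum_of_subset_of_nonneg Finset.inter_subset_right fun _ _ _ => hf _

theorem card_le_one_of_linForm_eq_zero {k : ℕ} {A : Fin k → ℕ} {B : Fin k → ℤ} (i : Fin k)
    (hA : 0 < A i) (s : Finset ℕ) :
    (s.filter fun n : ℕ => linForm A B i n = 0).card ≤ 1 := by
  refine Finset.card_le_one.mpr fun a ha b hb => ?_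
  have h1 := (Finset.mem_filter.mp ha).2
  have h2 := (Finset.mem_filter.mp hb).2
  unfold linForm at h1 h2
  have h3 : (A i : ℤ) * a = A i * b := by linarith
  exact_mod_cast mul_left_cancel₀ (by exact_mod_cast hA.ne') h3

section Splitting

variable {k : ℕ} {A : Fin k → ℕ} {B : Fin k → ℤ}

theorem sum_inv_sq_le_of_le {P : Finset ℕ} {z : ℝ} (hz : 0 < z) (hP : ∀ q ∈ P, z ≤ (q : ℝ)) :
    ∑ q ∈ P, ((q : ℝ) ^ 2)⁻¹ ≤ 2 / z := by
  have hc : 0 < ⌈z⌉₊ := Nat.ceil_pos.mpr hz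
  -- The tail bound runs over an open interval, hence the left end `⌈z⌉ - 1`; as `⌈z⌉ ≥ 1` the
  -- natural subtraction is exact.
  have h1 : ∑ q ∈ P, ((q : ℝ) ^ 2)⁻¹ ≤ 2 / ((⌈z⌉₊ - 1 : ℕ) + 1) := by
    refine le_trans (Finset.sum_le_sum_of_subset_of_nonneg ?_ fun _ _ _ => by positivity)
      (sum_Ioo_inv_sq_le (⌈z⌉₊ - 1) (P.sup id + 1))
    intro q hq
    refine Finset.mem_Ioo.mpr ⟨?_, Nat.lt_succ_of_le (Finset.le_sup (f := id) hq)⟩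
    have := Nat.ceil_le.mpr (hP q hq)
    omega
  refine h1.trans ?_
  rw [Nat.cast_sub hc, Nat.cast_one, sub_add_cancel]
  exact div_le_div_of_nonneg_left (by norm_num) hz (Nat.le_ceil z)

theorem card_le_of_forall_le {P : Finset ℕ} {z : ℝ} (hz : 0 ≤ z)
    (hP : ∀ q ∈ P, 0 < q ∧ (q : ℝ) ≤ z) : (P.card : ℝ) ≤ z := by
  have h1 : P.card ≤ (Finset.Ioc 0 ⌊z⌋₊).card := Finset.card_le_card fun q hq =>
    Finset.mem_Ioc.mpr ⟨(hP q hq).1, Nat.le_floor (hP q hq).2⟩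
  rw [Nat.card_Ioc, Nat.sub_zero] at h1
  exact (Nat.cast_le.mpr h1).trans (Nat.floor_le hz)

/-- The contribution of the `n` with `P(n) = 0`. -/
theorem sum_selbergSq_zero_le (hA : ∀ i, 0 < A i) (F : (Fin k → ℝ) → ℝ) (W : ℕ) (R : ℝ)
    (s : Finset ℕ) (hs : ∀ n ∈ s, ∃ i, linForm A B i n = 0) :
    ∑ n ∈ s, selbergSq A B F W R n ≤ k * (∑ d ∈ box k R, |lamWeight F W R d|) ^ 2 := by
  refine (sum_le_sum_cover s Finset.univ (fun i => s.filter fun n : ℕ => linForm A B i n = 0) _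
    (fun n => selbergSq_nonneg A B F W R n) fun n hn => ?_).trans ?_
  · obtain ⟨i, hi⟩ := hs n hn
    exact ⟨i, Finset.mem_univ i, Finset.mem_filter.mpr ⟨hn, hi⟩⟩
  · calc _ ≤ ∑ _i : Fin k, (∑ d ∈ box k R, |lamWeight F W R d|) ^ 2 := by
          refine Finset.sum_le_sum fun i _ => ?_
          refine (Finset.sum_le_card_nsmul _ (fun n : ℕ => selbergSq A B F W R n) _ fun n _ =>
            selbergSq_le_sq_sum_abs A B F W R n).trans ?_
          rw [nsmul_eq_mul]
          refine mul_le_of_le_one_left (sq_nonneg _) ?_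
          exact_mod_cast card_le_one_of_linForm_eq_zero i (hA i) s
      _ = _ := by simp

/-- The contribution of the `n` for which some `L_j(n)` is divisible by the square of a sieving prime
at most `Z`. -/
theorem sum_selbergSq_small_le (hk : 2 ≤ k) {W : ℕ} (hW : 0 < W) {R X N M Z z : ℝ}
    {P : Finset ℕ} (hP : IsSievePrimes P W X) (hgood : ∀ q ∈ P, IsGoodPrime A B q)
    (hRX : R ≤ X) (hN : 0 ≤ N) (hZ : 0 ≤ Z) (hz : 0 < z) (hPz : ∀ q ∈ P, z ≤ (q : ℝ)) (ν₀ : ℤ)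
    (F : (Fin k → ℝ) → ℝ) (hM : ∀ r, |yWeight F W R r| ≤ M) (s : Finset ℕ)
    (hs : ∀ n ∈ s, n ∈ Finset.Ioc ⌊N⌋₊ ⌊2 * N⌋₊ ∧ (n : ℤ) ≡ ν₀ [ZMOD (W : ℤ)] ∧
      ∃ j, ∃ p ∈ P, (p : ℝ) ≤ Z ∧ (p : ℤ) ^ 2 ∣ linForm A B j n) :
    ∑ n ∈ s, selbergSq A B F W R n ≤
      k * (N / W * ((k + 1) ^ 2 * M ^ 2 *
        (∑ m ∈ (Finset.range ⌈R⌉₊).filter (fun m => Squarefree m ∧ Nat.Coprime m W),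
          (m : ℝ) / (m.totient : ℝ) ^ 2) ^ k) * (2 / z) +
        Z * (2 * (∑ d ∈ box k R, |lamWeight F W R d|) ^ 2)) := by
  classical
  set S := (∑ m ∈ (Finset.range ⌈R⌉₊).filter (fun m => Squarefree m ∧ Nat.Coprime m W),
          (m : ℝ) / (m.totient : ℝ) ^ 2) with hS
  have hS0 : 0 ≤ S := Finset.sum_nonneg fun _ _ => by positivity
  set E := (∑ d ∈ box k R, |lamWeight F W R d|) ^ 2 with hE
  have hE0 : 0 ≤ E := sq_nonneg _
  set P' := P.filter fun p : ℕ => (p : ℝ) ≤ Z with hP'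
  refine (sum_le_sum_cover s ((Finset.univ : Finset (Fin k)) ×ˢ P')
    (fun x => (Finset.Ioc ⌊N⌋₊ ⌊2 * N⌋₊).filter (fun n : ℕ => (n : ℤ) ≡ ν₀ [ZMOD (W : ℤ)] ∧
        (x.2 : ℤ) ^ 2 ∣ linForm A B x.1 n)) _
    (fun n => selbergSq_nonneg A B F W R n) fun n hn => ?_).trans ?_
  · obtain ⟨h1, h2, j, p, hp, hpZ, hd⟩ := hs n hn
    exact ⟨(j, p), Finset.mem_product.mpr ⟨Finset.mem_univ j, Finset.mem_filter.mpr ⟨hp, hpZ⟩⟩,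
      Finset.mem_filter.mpr ⟨h1, h2, hd⟩⟩
  · rw [Finset.sum_product]
    have hj : ∀ j : Fin k, ∑ p ∈ P', ∑ n ∈ (Finset.Ioc ⌊N⌋₊ ⌊2 * N⌋₊).filter (fun n : ℕ =>
        (n : ℤ) ≡ ν₀ [ZMOD (W : ℤ)] ∧ (p : ℤ) ^ 2 ∣ linForm A B j n), selbergSq A B F W R n ≤
        N / W * ((k + 1) ^ 2 * M ^ 2 * S ^ k) * (2 / z) + Z * (2 * E) := by
      intro j
      calc _ ≤ ∑ p ∈ P', (N / W * ((k + 1) ^ 2 * M ^ 2 * S ^ k) * ((p : ℝ) ^ 2)⁻¹ + 2 * E) := by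
            refine Finset.sum_le_sum fun p hp => ?_
            have h := sum_selbergSq_prime_sq_le hk hW hP hgood hRX hN ν₀
              ⟨p, (Finset.mem_filter.mp hp).1⟩ j F hM
            refine le_trans (le_of_eq ?_) (h.trans (le_of_eq ?_))
            · congr!
            · rw [hS]
              ring
        _ = N / W * ((k + 1) ^ 2 * M ^ 2 * S ^ k) * (∑ p ∈ P', ((p : ℝ) ^ 2)⁻¹) +
            P'.card * (2 * E) := by
            rw [Finset.sum_add_distrib, Finset.mul_sum, Finset.sum_const, nsmul_eq_mul]
        _ ≤ _ := by
            have h1 : ∑ p ∈ P', ((p : ℝ) ^ 2)⁻¹ ≤ 2 / z :=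
              sum_inv_sq_le_of_le hz fun q hq => hPz q (Finset.mem_filter.mp hq).1
            have h2 : (P'.card : ℝ) ≤ Z := card_le_of_forall_le hZ fun q hq =>
              ⟨(hP.prime q (Finset.mem_filter.mp hq).1).pos, (Finset.mem_filter.mp hq).2⟩
            gcongr
    refine (Finset.sum_le_sum fun j _ => hj j).trans ?_
    rw [Finset.sum_const, Finset.card_univ, Fintype.card_fin, nsmul_eq_mul]

/-- The contribution of the `n` with `P(n) ≠ 0` for which some `L_j(n)` is divisible by the square of
a prime exceeding `Z`. -/
theorem sum_selbergSq_large_le (F : (Fin k → ℝ) → ℝ) (W : ℕ) {R N L Y Z : ℝ} (hN : 0 ≤ N)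
    (hL : 0 ≤ L) (hZ : 0 < Z) (s : Finset ℕ)
    (hs : ∀ n ∈ s, n ∈ Finset.Ioc ⌊N⌋₊ ⌊2 * N⌋₊ ∧ (∀ i, linForm A B i n ≠ 0) ∧
      (∀ i, ((linForm A B i n).natAbs : ℝ) ≤ Y) ∧ selbergSq A B F W R n ≤ L ∧
      ∃ j p, IsGoodPrime A B p ∧ Z ≤ (p : ℝ) ∧ (p : ℤ) ^ 2 ∣ linForm A B j n) :
    ∑ n ∈ s, selbergSq A B F W R n ≤ k * ((N * (2 / Z) + √Y * 2) * L) := by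
  classical
  -- From `p² ∣ L_j(n) ≠ 0` it follows that `p ≤ √Y`. This caps the number of moduli, each of which
  -- costs a counting error `2`.
  set Q := (Finset.Ioc 0 ⌊√Y⌋₊).filter fun p => IsGoodPrime A B p ∧ Z ≤ (p : ℝ) with hQ
  calc ∑ n ∈ s, selbergSq A B F W R n ≤ s.card * L := by
        rw [← nsmul_eq_mul]
        exact Finset.sum_le_card_nsmul _ _ _ fun n hn => (hs n hn).2.2.2.1
    _ ≤ (k * (N * (2 / Z) + √Y * 2)) * L := by
        refine mul_le_mul_of_nonneg_right ?_ hL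
        have h1 := sum_le_sum_cover s ((Finset.univ : Finset (Fin k)) ×ˢ Q)
          (fun x => (Finset.Ioc ⌊N⌋₊ ⌊2 * N⌋₊).filter (fun n : ℕ =>
            (x.2 : ℤ) ^ 2 ∣ linForm A B x.1 n)) (fun _ => (1 : ℝ)) (fun _ => zero_le_one)
          fun n hn => by
            obtain ⟨h1, h2, h3, -, j, p, hg, hpZ, hd⟩ := hs n hn
            refine ⟨(j, p), Finset.mem_product.mpr ⟨Finset.mem_univ j, Finset.mem_filter.mpr
              ⟨Finset.mem_Ioc.mpr ⟨hg.1.pos, Nat.le_floor (Real.le_sqrt_of_sq_le ?_)⟩, hg, hpZ⟩⟩,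
              Finset.mem_filter.mpr ⟨h1, hd⟩⟩
            have h4 : p ^ 2 ∣ (linForm A B j n).natAbs := by
              rw [← Int.natCast_dvd]
              exact_mod_cast hd
            have h5 := Nat.le_of_dvd (Nat.pos_of_ne_zero (Int.natAbs_ne_zero.mpr (h2 j))) h4
            exact le_trans (by exact_mod_cast h5) (h3 j)
        simp only [Finset.sum_const, nsmul_eq_mul, mul_one] at h1
        refine h1.trans ?_
        rw [Finset.sum_product]
        have hj : ∀ j : Fin k, ∑ p ∈ Q, (((Finset.Ioc ⌊N⌋₊ ⌊2 * N⌋₊).filter (fun n : ℕ =>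
            (p : ℤ) ^ 2 ∣ linForm A B j n)).card : ℝ) ≤ N * (2 / Z) + √Y * 2 := by
          intro j
          calc _ ≤ ∑ p ∈ Q, (N * ((p : ℝ) ^ 2)⁻¹ + 2) := by
                refine Finset.sum_le_sum fun p hp => ?_
                have hg := (Finset.mem_filter.mp hp).2.1
                obtain ⟨x, hx⟩ := hg.exists_root_sq j
                simp only [hx]
                have h := abs_card_modEq_sub_le hN (m := p ^ 2) (pow_pos hg.1.pos 2) x
                push_cast at h
                have h' := (abs_le.mp h).2
                rw [div_eq_mul_inv] at h'
                have e : (((Finset.Ioc ⌊N⌋₊ ⌊2 * N⌋₊).filter fun n : ℕ =>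
                    (n : ℤ) ≡ x [ZMOD (p : ℤ) ^ 2]).card : ℝ) ≤ N * ((p : ℝ) ^ 2)⁻¹ + 2 := by
                  linarith
                convert e
            _ = N * (∑ p ∈ Q, ((p : ℝ) ^ 2)⁻¹) + Q.card * 2 := by
                rw [Finset.sum_add_distrib, Finset.mul_sum, Finset.sum_const, nsmul_eq_mul]
            _ ≤ _ := by
                have h2 : ∑ p ∈ Q, ((p : ℝ) ^ 2)⁻¹ ≤ 2 / Z :=
                  sum_inv_sq_le_of_le hZ fun q hq => (Finset.mem_filter.mp hq).2.2
                have h3 : (Q.card : ℝ) ≤ √Y := card_le_of_forall_le (Real.sqrt_nonneg Y)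
                  fun q hq => by
                    have h4 := Finset.mem_Ioc.mp (Finset.mem_filter.mp hq).1
                    exact ⟨h4.1, (Nat.le_floor_iff (Real.sqrt_nonneg Y)).mp h4.2⟩
                gcongr
        refine (Finset.sum_le_sum fun j _ => hj j).trans ?_
        rw [Finset.sum_const, Finset.card_univ, Fintype.card_fin, nsmul_eq_mul]
    _ = _ := by ring

end Splitting

/-! ### Assembling the contributions and choosing parameters -/

section Conclusion

variable {k : ℕ} {A : Fin k → ℕ} {B : Fin k → ℤ}

theorem sum_nonSquarefreeSet_le (hk : 2 ≤ k) (hA : ∀ i, 0 < A i) (hAdm : Admissible A B)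
    {N R M Z L Y : ℝ} (hN : 16 < N) (hD : 0 < D0 N) (hAD : ∀ i, (A i : ℝ) < D0 N)
    (hdet : ∀ i j, (A i : ℝ) * (B j : ℝ) - (A j : ℝ) * (B i : ℝ) < D0 N) {ν₀ : ℤ}
    (hco : IsCoprime (formProd A B ν₀) (W N : ℤ)) (hRN : R ≤ N) (hZ : 1 ≤ Z) (hZN : Z ≤ N)
    (F : (Fin k → ℝ) → ℝ) (hM : ∀ r, |yWeight F (W N) R r| ≤ M) (hL : 0 ≤ L)
    (hY : ∀ n ∈ Finset.Ioc ⌊N⌋₊ ⌊2 * N⌋₊, ∀ i, ((linForm A B i n).natAbs : ℝ) ≤ Y)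
    (hLn : ∀ n ∈ Finset.Ioc ⌊N⌋₊ ⌊2 * N⌋₊, (∀ i, linForm A B i n ≠ 0) →
      selbergSq A B F (W N) R n ≤ L) :
    ∑ n ∈ nonSquarefreeSet A B N ν₀, selbergSq A B F (W N) R n ≤
      k * (∑ d ∈ box k R, |lamWeight F (W N) R d|) ^ 2 +
      k * (N / W N * ((k + 1) ^ 2 * M ^ 2 *
        (∑ m ∈ (Finset.range ⌈R⌉₊).filter (fun m => Squarefree m ∧ Nat.Coprime m (W N)),
          (m : ℝ) / (m.totient : ℝ) ^ 2) ^ k) * (2 / D0 N) +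
        Z * (2 * (∑ d ∈ box k R, |lamWeight F (W N) R d|) ^ 2)) +
      k * ((N * (2 / Z) + √Y * 2) * L) := by
  classical
  -- Taking primes up to `N` includes both the primes occurring in the weights, as `R ≤ N`, and all
  -- `p ≤ Z` whose squares are tested.
  set P := (Finset.range (⌊N⌋₊ + 1)).filter fun q => q.Prime ∧ ¬ q ∣ W N with hPdef
  have hP : IsSievePrimes P (W N) N := by
    intro q
    rw [hPdef, Finset.mem_filter, Finset.mem_range, Nat.lt_succ_iff,
      Nat.le_floor_iff (by linarith)]
    tauto
  have hgood : ∀ q : ℕ, q.Prime → ¬ q ∣ W N → IsGoodPrime A B q := fun q hq hqW =>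
    isGoodPrime_of_not_dvd_W hAdm hA hAD hdet hq hqW
  set S := nonSquarefreeSet A B N ν₀ with hS
  have hmem : ∀ n ∈ S, n ∈ Finset.Ioc ⌊N⌋₊ ⌊2 * N⌋₊ ∧ (n : ℤ) ≡ ν₀ [ZMOD (W N : ℤ)] ∧
      ¬ Squarefree (formProd A B (n : ℤ)) := by
    intro n hn
    rw [hS, nonSquarefreeSet, Finset.mem_filter] at hn
    exact hn
  set S₁ := S.filter fun n : ℕ => ∃ i, linForm A B i n = 0
  set S₂ := S.filter fun n : ℕ => ∃ j, ∃ p ∈ P, (p : ℝ) ≤ Z ∧ (p : ℤ) ^ 2 ∣ linForm A B j n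
  set S₃ := S.filter fun n : ℕ => (∀ i, linForm A B i n ≠ 0) ∧
    ∃ j p, IsGoodPrime A B p ∧ Z ≤ (p : ℝ) ∧ (p : ℤ) ^ 2 ∣ linForm A B j n
  have hcover := sum_le_sum_cover S (Finset.univ : Finset (Fin 3)) ![S₁, S₂, S₃]
    (fun n : ℕ => selbergSq A B F (W N) R n) (fun n => selbergSq_nonneg A B F (W N) R n) (by
      intro n hn
      by_cases h0 : ∃ i, linForm A B i n = 0
      · exact ⟨0, Finset.mem_univ _, Finset.mem_filter.mpr ⟨hn, h0⟩⟩
      · push Not at h0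
        obtain ⟨-, h1, h2⟩ := hmem n hn
        obtain ⟨j, p, hp, hpW, hd⟩ :=
          exists_prime_sq_dvd_linForm (isCoprime_formProd_of_modEq h1 hco) hgood h2
        by_cases hpZ : (p : ℝ) ≤ Z
        · exact ⟨1, Finset.mem_univ _, Finset.mem_filter.mpr
            ⟨hn, j, p, (hP p).mpr ⟨hp, hpW, hpZ.trans hZN⟩, hpZ, hd⟩⟩
        · exact ⟨2, Finset.mem_univ _, Finset.mem_filter.mpr
            ⟨hn, h0, j, p, hgood p hp hpW, (not_le.mp hpZ).le, hd⟩⟩)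
  rw [Fin.sum_univ_three] at hcover
  refine hcover.trans (add_le_add (add_le_add ?_ ?_) ?_)
  · exact sum_selbergSq_zero_le hA F (W N) R S₁ fun n hn => (Finset.mem_filter.mp hn).2
  · refine sum_selbergSq_small_le hk (W_pos N) hP (fun q hq => hgood q (hP.prime q hq)
      ((hP q).mp hq).2.1) hRN (by linarith) (by linarith) hD (fun q hq => ?_) ν₀ F hM S₂
      fun n hn => ?_
    · exact not_lt.mp fun h => ((hP q).mp hq).2.1 ((prime_dvd_W_iff (hP.prime q hq)).mpr h)
    · obtain ⟨h1, h2⟩ := Finset.mem_filter.mp hn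
      exact ⟨(hmem n h1).1, (hmem n h1).2.1, h2⟩
  · refine sum_selbergSq_large_le F (W N) (by linarith) hL (by linarith) S₃ fun n hn => ?_
    obtain ⟨h1, h2, h3⟩ := Finset.mem_filter.mp hn
    have h4 := (hmem n h1).1
    exact ⟨h4, h2, hY n h4, hLn n h4 h2, h3⟩

/-- Powers of `W` and of `log N` are absorbed by a power of `N`. -/
theorem exists_error_le (k : ℕ) {ϑ η : ℝ} (hϑ : 0 < ϑ) (hη : 0 < η) :
    ∃ C : ℝ, 0 < C ∧ ∀ N : ℝ, 16 < N → 0 < D0 N →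
      N ^ (1 - η) ≤ C * ((Nat.totient (W N) : ℝ) ^ k * N * Real.log (N ^ ϑ) ^ k /
            ((W N : ℝ) ^ (k + 1) * D0 N)) := by
  -- The denominator `W^(k+1) D₀` is `O((log N)^(2(k+1)+1))`; allowing `N^s` for each of these `2k +
  -- 3` logarithms costs `N^η`.
  set s : ℝ := η / (2 * k + 3) with hs
  have hs0 : 0 < s := by positivity
  refine ⟨Real.exp 2 ^ (k + 1) * (s⁻¹) ^ (2 * k + 3) / ϑ ^ k, by positivity, fun N hN hD => ?_⟩
  have hN0 : 0 < N := by linarith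
  have hlog := one_lt_log_of_sixteen_lt hN
  have hW : (0 : ℝ) < W N := by exact_mod_cast W_pos N
  have hφ : (1 : ℝ) ≤ (W N).totient := by exact_mod_cast Nat.totient_pos.mpr (W_pos N)
  have hden : 0 < (W N : ℝ) ^ (k + 1) * D0 N := by positivity
  have h1 : (W N : ℝ) ^ (k + 1) * D0 N ≤ Real.exp 2 ^ (k + 1) * (s⁻¹) ^ (2 * k + 3) * N ^ η := by
    calc (W N : ℝ) ^ (k + 1) * D0 N ≤ (Real.exp 2 * Real.log N ^ 2) ^ (k + 1) * Real.log N := by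
          refine mul_le_mul (pow_le_pow_left₀ hW.le (W_le hN hD) _) (D0_le_log hN) hD.le ?_
          positivity
      _ = Real.exp 2 ^ (k + 1) * Real.log N ^ (2 * k + 3) := by ring
      _ ≤ Real.exp 2 ^ (k + 1) * (N ^ s / s) ^ (2 * k + 3) := by
          refine mul_le_mul_of_nonneg_left ?_ (by positivity)
          exact pow_le_pow_left₀ (by linarith) (Real.log_le_rpow_div hN0.le hs0) _
      _ = Real.exp 2 ^ (k + 1) * (s⁻¹) ^ (2 * k + 3) * (N ^ s) ^ (2 * k + 3) := by
          rw [div_eq_mul_inv, mul_pow]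
          ring
      _ = _ := by
          rw [← Real.rpow_mul_natCast hN0.le]
          congr 2
          rw [hs]
          push_cast
          field_simp
  rw [Real.log_rpow hN0, mul_div_assoc', le_div_iff₀ hden]
  have h2 : ϑ ^ k ≤ (W N).totient ^ k * (ϑ * Real.log N) ^ k := by
    rw [← mul_pow]
    refine pow_le_pow_left₀ hϑ.le ?_ k
    have : 1 ≤ ((W N).totient : ℝ) * Real.log N := by nlinarith
    nlinarith
  calc N ^ (1 - η) * ((W N : ℝ) ^ (k + 1) * D0 N) ≤
        N ^ (1 - η) * (Real.exp 2 ^ (k + 1) * (s⁻¹) ^ (2 * k + 3) * N ^ η) := by gcongr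
    _ = Real.exp 2 ^ (k + 1) * (s⁻¹) ^ (2 * k + 3) * (N ^ (1 - η) * N ^ η) := by ring
    _ = Real.exp 2 ^ (k + 1) * (s⁻¹) ^ (2 * k + 3) * N := by
        rw [← Real.rpow_add hN0, sub_add_cancel, Real.rpow_one]
    _ = Real.exp 2 ^ (k + 1) * (s⁻¹) ^ (2 * k + 3) / ϑ ^ k * N * ϑ ^ k := by
        field_simp
    _ ≤ Real.exp 2 ^ (k + 1) * (s⁻¹) ^ (2 * k + 3) / ϑ ^ k * N *
        ((W N).totient ^ k * (ϑ * Real.log N) ^ k) := by gcongr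
    _ = _ := by ring

theorem one_add_log_W_mul_le {N ϑ : ℝ} (hN : 16 < N) (hD : 0 < D0 N) (hϑ : 0 < ϑ) :
    1 + Real.log ((W N * ⌈N ^ ϑ⌉₊ : ℕ) : ℝ) ≤ (6 + ϑ) / ϑ * Real.log (N ^ ϑ) := by
  have hN0 : 0 < N := by linarith
  have hlog := one_lt_log_of_sixteen_lt hN
  have hR : 1 ≤ N ^ ϑ := Real.one_le_rpow (by linarith) hϑ.le
  have hW : (0 : ℝ) < W N := by exact_mod_cast W_pos N
  have hc0 : (0 : ℝ) < ⌈N ^ ϑ⌉₊ := by exact_mod_cast Nat.ceil_pos.mpr (by linarith)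
  have hc : (⌈N ^ ϑ⌉₊ : ℝ) ≤ 2 * N ^ ϑ := by
    have := Nat.ceil_lt_add_one (by linarith : 0 ≤ N ^ ϑ)
    linarith
  have h1 : Real.log (W N) ≤ 2 + 2 * Real.log N := by
    refine (Real.log_le_log hW (W_le hN hD)).trans ?_
    rw [Real.log_mul (Real.exp_pos 2).ne' (by positivity), Real.log_exp, Real.log_pow]
    have := Real.log_le_sub_one_of_pos (by linarith : 0 < Real.log N)
    push_cast
    linarith
  have h2 : Real.log ⌈N ^ ϑ⌉₊ ≤ 1 + ϑ * Real.log N := by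
    refine (Real.log_le_log hc0 hc).trans ?_
    rw [Real.log_mul (by norm_num) (by linarith), Real.log_rpow hN0]
    have := Real.log_two_lt_d9
    linarith
  push_cast
  rw [Real.log_mul hW.ne' hc0.ne', Real.log_rpow hN0]
  have h3 : (6 + ϑ) / ϑ * (ϑ * Real.log N) = (6 + ϑ) * Real.log N := by
    field_simp
  rw [h3]
  -- The bounds add up to `4 + (2 + ϑ) log N`, and `log N > 1`.
  nlinarith

theorem natAbs_linForm_le {N : ℝ} (hN : 1 ≤ N) {n : ℕ} (hn : n ∈ Finset.Ioc ⌊N⌋₊ ⌊2 * N⌋₊)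
    (i : Fin k) :
    ((linForm A B i n).natAbs : ℝ) ≤ (1 + ∑ i, (2 * (A i : ℝ) + |(B i : ℝ)|)) * N := by
  have h1 : (n : ℝ) ≤ 2 * N := (Nat.le_floor_iff (by linarith)).mp (Finset.mem_Ioc.mp hn).2
  have h2 : 2 * (A i : ℝ) + |(B i : ℝ)| ≤ ∑ i, (2 * (A i : ℝ) + |(B i : ℝ)|) :=
    Finset.single_le_sum (f := fun i => 2 * (A i : ℝ) + |(B i : ℝ)|)
      (fun i _ => by positivity) (Finset.mem_univ i)
  rw [Nat.cast_natAbs]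
  unfold linForm
  push_cast
  have h3 : (0 : ℝ) ≤ A i := Nat.cast_nonneg _
  have h4 : 0 ≤ |(B i : ℝ)| := abs_nonneg _
  calc |(A i : ℝ) * n + B i| ≤ |(A i : ℝ) * n| + |(B i : ℝ)| := abs_add_le _ _
    _ = (A i : ℝ) * n + |(B i : ℝ)| := by rw [abs_of_nonneg (by positivity)]
    _ ≤ (A i : ℝ) * (2 * N) + |(B i : ℝ)| * N := by
        refine add_le_add (mul_le_mul_of_nonneg_left h1 h3) (le_mul_of_one_le_right h4 hN)
    _ = (2 * (A i : ℝ) + |(B i : ℝ)|) * N := by ring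
    _ ≤ _ := mul_le_mul_of_nonneg_right (by linarith) (by linarith)

/-- The bound for weights `y` of size at most `M` supported on `r ≤ N ^ (1 / 2 - η)`. -/
theorem exists_sum_nonSquarefreeSet_le (hk : 2 ≤ k) (hA : ∀ i, 0 < A i) (hAdm : Admissible A B)
    {ϑ η : ℝ} (hϑ : 0 < ϑ) (hϑ1 : ϑ ≤ 1) (hη : 0 < η) (hη2 : η ≤ 1 / 2) :
    ∃ C : ℝ, 0 < C ∧ ∀ (F : (Fin k → ℝ) → ℝ) (M N : ℝ), 16 < N → 0 < D0 N →
      (∀ i, (A i : ℝ) < D0 N) →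
      (∀ i j, (A i : ℝ) * (B j : ℝ) - (A j : ℝ) * (B i : ℝ) < D0 N) →
      (∀ r, |yWeight F (W N) (N ^ ϑ) r| ≤ M) →
      (∀ r, yWeight F (W N) (N ^ ϑ) r ≠ 0 → ((∏ i, r i : ℕ) : ℝ) ≤ N ^ (1 / 2 - η)) →
      ∀ ν₀ : ℤ, IsCoprime (formProd A B ν₀) (W N : ℤ) →
        ∑ n ∈ nonSquarefreeSet A B N ν₀, selbergSq A B F (W N) (N ^ ϑ) (n : ℤ) ≤
          C * ((Nat.totient (W N) : ℝ) ^ k * N * Real.log (N ^ ϑ) ^ k /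
            ((W N : ℝ) ^ (k + 1) * D0 N)) * M ^ 2 := by
  obtain ⟨C₁, hC₁, h₁⟩ := exists_sum_abs_lamWeight_le k (ε := η / 4) (by positivity)
  obtain ⟨C₂, hC₂, h₂⟩ := exists_selbergSq_le k (ε := η / 2) (by positivity)
  obtain ⟨C₃, hC₃, h₃⟩ := exists_error_le k hϑ (half_pos hη)
  set H : ℝ := 1 + ∑ i, (2 * (A i : ℝ) + |(B i : ℝ)|) with hH
  have hH1 : 1 ≤ H := by
    have : 0 ≤ ∑ i, (2 * (A i : ℝ) + |(B i : ℝ)|) := Finset.sum_nonneg fun i _ => by positivity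
    linarith
  set K : ℝ := 3 * k * C₁ ^ 2 + k * ((2 + 2 * √H) * (C₂ * H ^ (η / 2))) with hK
  set K' : ℝ := k * (k + 1) ^ 2 * 2 * (Real.exp 8 * ((6 + ϑ) / ϑ)) ^ k with hK'
  have hk0 : (0 : ℝ) < k := by exact_mod_cast (by omega : 0 < k)
  refine ⟨K * C₃ + K', by positivity, fun F M N hN hD hAD hdet hM hsupp ν₀ hco => ?_⟩
  have hN0 : 0 < N := by linarith
  have hN1 : 1 ≤ N := by linarith
  set R := N ^ ϑ with hR
  have hM0 : 0 ≤ M := (abs_nonneg _).trans (hM fun _ => 0)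
  have hR1 : 1 ≤ R := Real.one_le_rpow hN1 hϑ.le
  have hRN : R ≤ N := by
    calc R ≤ N ^ (1 : ℝ) := Real.rpow_le_rpow_of_exponent_le hN1 hϑ1
      _ = N := Real.rpow_one N
  -- The cut at `N^η` balances the errors: up to constants and `M²`, small primes cost `N^η (N^(1/2
  -- - 3η/4))² = N^(1 - η/2)` and large ones `N^(1 - η) N^(η/2)`.
  have hmain := sum_nonSquarefreeSet_le hk hA hAdm hN hD hAD hdet hco hRN
    (Z := N ^ η) (L := C₂ * M ^ 2 * (H * N) ^ (η / 2)) (Y := H * N)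
    (Real.one_le_rpow hN1 hη.le)
    (by
      calc N ^ η ≤ N ^ (1 : ℝ) := Real.rpow_le_rpow_of_exponent_le hN1 (by linarith)
        _ = N := Real.rpow_one N) F hM (by positivity)
    (fun n hn i => natAbs_linForm_le hN1 hn i)
    (fun n hn hne => h₂ A B F (W N) R M (H * N) n hR1 (by nlinarith) hM hne
      fun i => natAbs_linForm_le hN1 hn i)
  set E := (∑ d ∈ box k R, |lamWeight F (W N) R d|) ^ 2 with hE
  set S := ∑ m ∈ (Finset.range ⌈R⌉₊).filter (fun m => Squarefree m ∧ Nat.Coprime m (W N)),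
          (m : ℝ) / (m.totient : ℝ) ^ 2 with hS
  set Φ := (Nat.totient (W N) : ℝ) ^ k * N * Real.log R ^ k / ((W N : ℝ) ^ (k + 1) * D0 N) with hΦ
  have hErr : N ^ (1 - η / 2) ≤ C₃ * Φ := h₃ N hN hD
  have hEle : N ^ η * E ≤ C₁ ^ 2 * M ^ 2 * N ^ (1 - η / 2) := by
    have e1 : ∑ d ∈ box k R, |lamWeight F (W N) R d| ≤ C₁ * M * N ^ (1 / 2 - 3 * η / 4) := by
      refine (h₁ F (W N) R M (N ^ (1 / 2 - η)) hR1 (by positivity) hM hsupp).trans ?_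
      calc _ ≤ C₁ * M * N ^ (1 / 2 - η) * N ^ (η / 4) := by gcongr
        _ = C₁ * M * (N ^ (1 / 2 - η) * N ^ (η / 4)) := by ring
        _ = _ := by
          rw [← Real.rpow_add hN0]
          congr 2
          ring
    have e2 : E ≤ (C₁ * M * N ^ (1 / 2 - 3 * η / 4)) ^ 2 :=
      pow_le_pow_left₀ (Finset.sum_nonneg fun _ _ => abs_nonneg _) e1 2
    calc N ^ η * E ≤ N ^ η * (C₁ * M * N ^ (1 / 2 - 3 * η / 4)) ^ 2 := by gcongr
      _ = C₁ ^ 2 * M ^ 2 * (N ^ η * (N ^ (1 / 2 - 3 * η / 4) * N ^ (1 / 2 - 3 * η / 4))) := by ring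
      _ = _ := by
        rw [← Real.rpow_add hN0, ← Real.rpow_add hN0]
        congr 2
        ring
  have hE1 : E ≤ N ^ η * E :=
    le_mul_of_one_le_left (sq_nonneg _) (Real.one_le_rpow hN1 hη.le)
  have hLle : (N * (2 / N ^ η) + √(H * N) * 2) * (C₂ * M ^ 2 * (H * N) ^ (η / 2)) ≤
      (2 + 2 * √H) * (C₂ * H ^ (η / 2)) * M ^ 2 * N ^ (1 - η / 2) := by
    have e1 : N * (2 / N ^ η) = 2 * N ^ (1 - η) := by
      rw [Real.rpow_sub hN0, Real.rpow_one]
      ring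
    -- Here `η ≤ 1/2` is used, so that `N^(1/2) ≤ N^(1 - η)`.
    have e2 : √(H * N) ≤ √H * N ^ (1 - η) := by
      rw [Real.sqrt_mul (by linarith)]
      refine mul_le_mul_of_nonneg_left ?_ (Real.sqrt_nonneg H)
      rw [Real.sqrt_eq_rpow]
      exact Real.rpow_le_rpow_of_exponent_le hN1 (by linarith)
    have e3 : (H * N) ^ (η / 2) = H ^ (η / 2) * N ^ (η / 2) :=
      Real.mul_rpow (by linarith) hN0.le
    have e4 : N ^ (1 - η) * N ^ (η / 2) = N ^ (1 - η / 2) := by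
      rw [← Real.rpow_add hN0]
      congr 1
      ring
    rw [e1, e3]
    calc _ ≤ (2 * N ^ (1 - η) + (√H * N ^ (1 - η)) * 2) *
          (C₂ * M ^ 2 * (H ^ (η / 2) * N ^ (η / 2))) := by gcongr
      _ = (2 + 2 * √H) * (C₂ * H ^ (η / 2)) * M ^ 2 * (N ^ (1 - η) * N ^ (η / 2)) := by ring
      _ = _ := by rw [e4]
  have hW : (0 : ℝ) < W N := by exact_mod_cast W_pos N
  have hSle : S ≤ (W N).totient / W N * (Real.exp 8 * ((6 + ϑ) / ϑ)) * Real.log R := by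
    refine (sum_ratio_coprime_le (squarefree_W N) ⌈R⌉₊).trans ?_
    rw [mul_assoc, mul_assoc]
    exact mul_le_mul_of_nonneg_left (mul_le_mul_of_nonneg_left
      (one_add_log_W_mul_le hN hD hϑ) (Real.exp_pos 8).le) (by positivity)
  have hS0 : 0 ≤ S := Finset.sum_nonneg fun _ _ => by positivity
  have hMain : k * (N / W N * ((k + 1) ^ 2 * M ^ 2 * S ^ k) * (2 / D0 N)) ≤ K' * Φ * M ^ 2 := by
    calc _ ≤ k * (N / W N * ((k + 1) ^ 2 * M ^ 2 *
          ((W N).totient / W N * (Real.exp 8 * ((6 + ϑ) / ϑ)) * Real.log R) ^ k) *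
            (2 / D0 N)) := by gcongr
      _ = K' * Φ * M ^ 2 := by
        rw [hK', hΦ, mul_pow, mul_pow ((W N).totient / W N : ℝ), div_pow]
        field_simp
        ring
  have hKE : K * M ^ 2 * N ^ (1 - η / 2) ≤ K * M ^ 2 * (C₃ * Φ) :=
    mul_le_mul_of_nonneg_left hErr (by positivity)
  refine hmain.trans ?_
  calc _ = (k * E + 2 * k * (N ^ η * E)) +
        k * (N / W N * ((k + 1) ^ 2 * M ^ 2 * S ^ k) * (2 / D0 N)) +
        k * ((N * (2 / N ^ η) + √(H * N) * 2) * (C₂ * M ^ 2 * (H * N) ^ (η / 2))) := by ring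
    _ ≤ (k * (C₁ ^ 2 * M ^ 2 * N ^ (1 - η / 2)) + 2 * k * (C₁ ^ 2 * M ^ 2 * N ^ (1 - η / 2))) +
        K' * Φ * M ^ 2 +
        k * ((2 + 2 * √H) * (C₂ * H ^ (η / 2)) * M ^ 2 * N ^ (1 - η / 2)) :=
        add_le_add (add_le_add (add_le_add
          (mul_le_mul_of_nonneg_left (hE1.trans hEle) hk0.le)
          (mul_le_mul_of_nonneg_left hEle (by positivity))) hMain)
          (mul_le_mul_of_nonneg_left hLle hk0.le)
    _ = K * M ^ 2 * N ^ (1 - η / 2) + K' * Φ * M ^ 2 := by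
        rw [hK]
        ring
    _ ≤ K * M ^ 2 * (C₃ * Φ) + K' * Φ * M ^ 2 := by gcongr
    _ = _ := by ring

/-! ### The support of the weights -/

theorem prod_le_of_simplexRegion {F : (Fin k → ℝ) → ℝ} {W : ℕ} {R : ℝ} (hR : 1 < R)
    (hF : Function.support F ⊆ simplexRegion k) {r : Fin k → ℕ} (h : yWeight F W R r ≠ 0) :
    ((∏ i, r i : ℕ) : ℝ) ≤ R := by
  have hpos : ∀ i, (0 : ℝ) < r i := fun i => by exact_mod_cast pos_of_yWeight_ne_zero h i
  have hy := h
  unfold yWeight at hy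
  rw [if_pos (yWeight_conditions h)] at hy
  have h1 := (hF hy).2
  rw [← Finset.sum_div, div_le_one (Real.log_pos hR),
    ← Real.log_prod fun i _ => (hpos i).ne'] at h1
  push_cast
  exact (Real.log_le_log_iff (Finset.prod_pos fun i _ => hpos i) (by linarith)).mp h1

/-- Multiplying the `k` truncation conditions `r / r_j < R` counts every `r_i` exactly `k - 1`
times. -/
theorem prod_pow_le {F : (Fin k → ℝ) → ℝ} {W : ℕ} {R : ℝ} {r : Fin k → ℕ}
    (h : yWeight F W R r ≠ 0) : ((∏ i, r i : ℕ) : ℝ) ^ (k - 1) ≤ R ^ k := by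
  have h1 : ∏ j, ∏ i ∈ Finset.univ.erase j, r i = (∏ i, r i) ^ (k - 1) := by
    rw [Finset.prod_comm' (t' := Finset.univ) (s' := fun i => Finset.univ.erase i)
      (by simp [ne_comm]), ← Finset.prod_pow]
    refine Finset.prod_congr rfl fun i _ => ?_
    rw [Finset.prod_const, Finset.card_erase_of_mem (Finset.mem_univ i), Finset.card_univ,
      Fintype.card_fin]
  calc ((∏ i, r i : ℕ) : ℝ) ^ (k - 1) = ∏ j, ((∏ i ∈ Finset.univ.erase j, r i : ℕ) : ℝ) := by
        rw [← Nat.cast_pow, ← h1, Nat.cast_prod]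
    _ ≤ ∏ _j : Fin k, R := Finset.prod_le_prod (fun _ _ => Nat.cast_nonneg _)
        fun j _ => ((yWeight_conditions h).2.2 j).le
    _ = R ^ k := by rw [Finset.prod_const, Finset.card_univ, Fintype.card_fin]

/-- By `prod_pow_le` the product is at most `R^(k/(k-1))`, and the threshold `(k - 1) / (2k)` is
what brings this exponent of `N` below `1/2 - η`. -/
theorem prod_le_of_extended {F : (Fin k → ℝ) → ℝ} {W : ℕ} {N ϑ η : ℝ} (hk : 2 ≤ k) (hN : 1 ≤ N)
    (hη : 0 < η) (hϑ : ϑ < ((k : ℝ) - 1) / (2 * (k : ℝ)) - η) {r : Fin k → ℕ}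
    (h : yWeight F W (N ^ ϑ) r ≠ 0) : ((∏ i, r i : ℕ) : ℝ) ≤ N ^ (1 / 2 - η) := by
  have hN0 : 0 < N := by linarith
  have hk2 : (2 : ℝ) ≤ k := by exact_mod_cast hk
  have h1 : ϑ * k ≤ (1 / 2 - η) * ((k - 1 : ℕ) : ℝ) := by
    have e : ((k : ℝ) - 1) / (2 * k) * k = (k - 1) / 2 := by
      field_simp
    have := mul_lt_mul_of_pos_right hϑ (by linarith : (0 : ℝ) < k)
    rw [sub_mul, e] at this
    rw [Nat.cast_sub (by omega)]
    push_cast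
    nlinarith
  refine le_of_pow_le_pow_left₀ (n := k - 1) (by omega) (by positivity) ?_
  refine (prod_pow_le h).trans ?_
  rw [← Real.rpow_mul_natCast hN0.le, ← Real.rpow_mul_natCast hN0.le]
  exact Real.rpow_le_rpow_of_exponent_le hN h1

theorem abs_le_Fmax {F : (Fin k → ℝ) → ℝ} (hfin : Fmax F ≠ ⊤)
    (hF : ∀ t, F t ≠ 0 → ∀ i, t i ∈ Set.Icc (0 : ℝ) 1) (t : Fin k → ℝ) :
    |F t| ≤ (Fmax F).toReal := by
  by_cases h : F t = 0
  · rw [h, abs_zero]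
    exact ENNReal.toReal_nonneg
  · have h1 : ENNReal.ofReal (|F t| + ∑ i, |lineDeriv ℝ F t (Pi.single i 1)|) ≤ Fmax F :=
      le_iSup₂_of_le (f := fun (t : Fin k → ℝ)
        (_ : t ∈ {t : Fin k → ℝ | ∀ i, t i ∈ Set.Icc (0 : ℝ) 1}) =>
        ENNReal.ofReal (|F t| + ∑ i, |lineDeriv ℝ F t (Pi.single i 1)|)) t (hF t h) le_rfl
    have h2 := (ENNReal.ofReal_le_iff_le_toReal hfin).mp h1
    have h3 : 0 ≤ ∑ i, |lineDeriv ℝ F t (Pi.single i 1)| :=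
      Finset.sum_nonneg fun _ _ => abs_nonneg _
    linarith

end Conclusion

end AlmostPrimeTuples

/-! ### Deduction of the bound in `[0, ∞]` -/

open AlmostPrimeTuples in
theorem proposition1p12 (k : ℕ) (hk : 3 ≤ k) (A : Fin k → ℕ) (B : Fin k → ℤ)
    (hA : ∀ i, 0 < A i) (hAdm : Admissible A B)
    (ϑ η : ℝ) (hϑ : 0 < ϑ) (hη : 0 < η) :
    ∃ C : ℝ, 0 < C ∧
      ∀ F : (Fin k → ℝ) → ℝ, (∀ t, 0 ≤ F t) →
        ((ϑ < 1 / 2 - η ∧ Function.support F ⊆ simplexRegion k ∧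
            DifferentiableOn ℝ F (interior (simplexRegion k))) ∨
          (ϑ < ((k : ℝ) - 1) / (2 * (k : ℝ)) - η ∧ Function.support F ⊆ extendedRegion k ∧
            DifferentiableOn ℝ F (interior (extendedRegion k)))) →
      ∀ N : ℝ, 16 < N →
        (∀ i, (A i : ℝ) < D0 N) →
        (∀ i j, (A i : ℝ) * (B j : ℝ) - (A j : ℝ) * (B i : ℝ) < D0 N) →
      ∀ ν₀ : ℤ, IsCoprime (formProd A B ν₀) (W N : ℤ) →
        ENNReal.ofReal (∑ n ∈ nonSquarefreeSet A B N ν₀,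
            selbergSq A B F (W N) (N ^ ϑ) (n : ℤ)) ≤
          ENNReal.ofReal (C * ((Nat.totient (W N) : ℝ) ^ k * N * Real.log (N ^ ϑ) ^ k /
            ((W N : ℝ) ^ (k + 1) * D0 N))) * Fmax F ^ 2 := by
  have hk0 : (0 : ℝ) < k := by exact_mod_cast (by omega : 0 < k)
  by_cases hsum : ϑ + η < 1 / 2
  swap
  -- Both alternatives force `ϑ + η < 1/2`, so otherwise no `F` qualifies and any constant serves.
  · refine ⟨1, one_pos, fun F _ hF => ?_⟩
    exfalso
    have h1 : ((k : ℝ) - 1) / (2 * (k : ℝ)) ≤ 1 / 2 := by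
      rw [div_le_div_iff₀ (by positivity) (by norm_num)]
      linarith
    rcases hF with ⟨h, -⟩ | ⟨h, -⟩ <;> linarith
  obtain ⟨C, hC, h⟩ := exists_sum_nonSquarefreeSet_le (by omega) hA hAdm hϑ (by linarith) hη
    (by linarith)
  refine ⟨C, hC, fun F _ hF N hN hAD hdet ν₀ hco => ?_⟩
  -- Positivity of `D₀`, not implied by `N > 16`, comes from `D₀ > A_i ≥ 0`.
  have hD : 0 < D0 N := (Nat.cast_nonneg _).trans_lt (hAD ⟨0, by omega⟩)
  have hN0 : 0 < N := by linarith
  have hR : 1 < N ^ ϑ := Real.one_lt_rpow (by linarith) hϑ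
  have hW : (0 : ℝ) < W N := by exact_mod_cast W_pos N
  have hφ : (0 : ℝ) < (W N).totient := by exact_mod_cast Nat.totient_pos.mpr (W_pos N)
  have hlog : 0 < Real.log (N ^ ϑ) := Real.log_pos hR
  have hcoef : 0 < C * ((Nat.totient (W N) : ℝ) ^ k * N * Real.log (N ^ ϑ) ^ k /
      ((W N : ℝ) ^ (k + 1) * D0 N)) := by positivity
  by_cases hfin : Fmax F = ⊤
  -- The coefficient is positive, so the right side is `⊤` and not the degenerate product `0 * ⊤ =
  -- 0`.
  · rw [hfin, ENNReal.top_pow two_ne_zero, ENNReal.mul_top (ENNReal.ofReal_pos.mpr hcoef).ne']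
    exact le_top
  have hcube : ∀ t, F t ≠ 0 → ∀ i, t i ∈ Set.Icc (0 : ℝ) 1 := by
    rcases hF with ⟨-, hsupp, -⟩ | ⟨-, hsupp, -⟩
    · exact fun t ht => (hsupp ht).1
    · exact fun t ht => (hsupp ht).1
  have hM : ∀ r, |yWeight F (W N) (N ^ ϑ) r| ≤ (Fmax F).toReal := by
    intro r
    unfold yWeight
    split_ifs
    · exact abs_le_Fmax hfin hcube _
    · rw [abs_zero]
      exact ENNReal.toReal_nonneg
  have hprod : ∀ r, yWeight F (W N) (N ^ ϑ) r ≠ 0 →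
      ((∏ i, r i : ℕ) : ℝ) ≤ N ^ (1 / 2 - η) := by
    intro r hr
    rcases hF with ⟨hlt, hsupp, -⟩ | ⟨hlt, -, -⟩
    · exact (prod_le_of_simplexRegion hR hsupp hr).trans
        (Real.rpow_le_rpow_of_exponent_le (by linarith) hlt.le)
    · exact prod_le_of_extended (by omega) (by linarith) hη hlt hr
  have hmain := h F (Fmax F).toReal N hN hD hAD hdet hM hprod ν₀ hco
  refine (ENNReal.ofReal_le_ofReal hmain).trans (le_of_eq ?_)
  rw [ENNReal.ofReal_mul hcoef.le, ENNReal.ofReal_pow ENNReal.toReal_nonneg,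
    ENNReal.ofReal_toReal hfin]
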